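/- Let $d,d^\star\in\mathbb N$; inequalities between vectors are componentwise. For $j,m\in\{1,\dots,d\}$ let $\overline\lambda_j\ge 0$ be base rates, not all zero; let $g_{mj}:[0,\infty)\to[0,\infty)$ be non-increasing and integrable with $c_{mj}=\int_0^\infty g_{mj}(v)\,dv$; let $\mathbf B_j=(B_{1j},\dots,B_{dj})$ and $\mathbf U_j=(U_{1j},\dots,U_{d^\star j})$ be random vectors with non-negative entries. Let $\mathbf N=(N_1,\dots,N_d)$ be the Hawkes process in its cluster representation: immigrants arrive in component $j$ as independent Poisson processes of rate $\overline\lambda_j$ on $(0,\infty)$; every event in component $j$ at time $s$ has an independent copy $(b_1,\dots,b_d)$ of $\mathbf B_j$ as marks and, given these, produces children in each component $m$ at the points of independent Poisson processes of intensity $b_m g_{mj}(\cdot-s)$ on $(s,\infty)$; $N_j(t)$ counts all events in component $j$ up to time $t$. Let $\mathbf Z(t)=\sum_{j=1}^d\sum_{r=1}^{N_j(t)}\mathbf U_{j,r}$ with independent copies $\mathbf U_{j,r}$ of $\mathbf U_j$, independent of $\mathbf N$. Let $S_{l\leftarrow j}$ be the total number of events in component $l$ in the cluster of an immigrant in component $j$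 (immigrant included), and put $$f_j(\mathbf z)=\mathbb E\Big[\prod_{l=1}^d z_l^{S_{l\leftarrow j}}\Big]\in[0,\infty],\qquad m_{\mathbf U_j}(\theta)=\mathbb E\big[e^{\theta^\top\mathbf U_j}\big],\qquad \mathbf m_{\mathbf U}=(m_{\mathbf U_1},\dots,m_{\mathbf U_d}),$$ $$\Lambda(\theta)=\sum_{j=1}^d\overline\lambda_j\big(f_j(\mathbf m_{\mathbf U}(\theta))-1\big)\in(-\infty,\infty],\qquad \mathscr D_\Lambda=\{\theta\in\mathbb R^{d^\star}:\Lambda(\theta)<\infty\}.$$ Assume that the matrix $(\mathbb E[B_{mj}]c_{mj})_{m,j}$ has spectral radius smaller than $1$, and that for some $\vartheta\in\mathbb R^d$ with positive entries $\mathbb E[\exp(\sum_m B_{mj}\vartheta_m)]<\infty$ for all $j$. Then the following hold. (1) If $m_{\mathbf U_j}(\eta)<\infty$ for all $j$, for some $\eta\in\mathbb R^{d^\star}$ with positive entries (equivalently, if $\mathbf m_{\mathbf U}$ is finite in a neighbourhood of the origin), then $\mathbf 0$ is an interior point of $\mathscr D_\Lambda$. (2) Let $\mathbf r\in\mathbb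 R^d$ have positive entries, let $\hat{\mathbf x}\in\mathbb R^d$ solve, with all expectations finite, $$\hat x_j\sum_{k=1}^d r_k\,\mathbb E\Big[B_{kj}c_{kj}e^{\sum_m B_{mj}c_{mj}(\hat x_m-1)}\Big]=r_j\,\mathbb E\Big[e^{\sum_m B_{mj}c_{mj}(\hat x_m-1)}\Big]\qquad(1\le j\le d),$$ and let $$\hat z_j=r_j\Big(\sum_{k=1}^d r_k\,\mathbb E\Big[B_{kj}c_{kj}e^{\sum_m B_{mj}c_{mj}(\hat x_m-1)}\Big]\Big)^{-1}\qquad(1\le j\le d).$$ Suppose that $\hat{\mathbf z}\ge\mathbf 1$ and that $\hat\theta\in\mathbb R^{d^\star}$ satisfies $\mathbf m_{\mathbf U}(\hat\theta)=\hat{\mathbf z}$. Then for every $\theta\in\mathbb R^{d^\star}$ with $\theta\le\hat\theta$ one has $\theta\in\mathscr D_\Lambda$ and $$\lim_{t\to\infty}\frac1t\log\mathbb E\big[e^{\theta^\top\mathbf Z(t)}\big]=\Lambda(\theta).$$ -/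

import Mathlib

open MeasureTheory ProbabilityTheory Filter Topology
open scoped ENNReal NNReal

/-- The primitives of a `d`-variate Hawkes process with random marks, together with the laws of the
`dstar`-dimensional claims of the compound process.  The first index of `decay m j` is the component
that receives the offspring, the second one is the component of the parent. -/
structure HawkesModel (d dstar : ℕ) where
  /-- base rates of the immigrant processes -/
  rate : Fin d → ℝ≥0
  exists_rate_pos : ∃ j, 0 < rate j
  /-- decay functions `g m j`, of which only the restriction to `[0, ∞)` is used -/
  decay : Fin d → Fin d → ℝ → ℝ
  decay_nonneg : ∀ m j t, 0 ≤ t → 0 ≤ decay m j t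
  decay_antitone : ∀ m j, AntitoneOn (decay m j) (Set.Ici 0)
  decay_integrable : ∀ m j, IntegrableOn (decay m j) (Set.Ioi 0)
  /-- law of the mark vector `B_j = (B_{1j}, …, B_{dj})` of an event in component `j` -/
  markLaw : Fin d → Measure (Fin d → ℝ)
  markLaw_prob : ∀ j, IsProbabilityMeasure (markLaw j)
  markLaw_nonneg : ∀ j, ∀ᵐ b ∂(markLaw j), ∀ m, 0 ≤ b m
  /-- law of the claim vector `U_j = (U_{1j}, …, U_{dstar j})` of an event in component `j` -/
  claimLaw : Fin d → Measure (Fin dstar → ℝ)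
  claimLaw_prob : ∀ j, IsProbabilityMeasure (claimLaw j)
  claimLaw_nonneg : ∀ j, ∀ᵐ v ∂(claimLaw j), ∀ i, 0 ≤ v i

namespace HawkesModel

variable {d dstar : ℕ} (M : HawkesModel d dstar)

instance (j : Fin d) : IsProbabilityMeasure (M.markLaw j) := M.markLaw_prob j

instance (j : Fin d) : IsProbabilityMeasure (M.claimLaw j) := M.claimLaw_prob j

/-- `c_{mj} = ∫_0^∞ g_{mj}(v) dv`. -/
noncomputable def c (m j : Fin d) : ℝ := ∫ v in Set.Ioi (0 : ℝ), M.decay m j v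

/-- The matrix `H = (E[B_{mj}] c_{mj})`. -/
noncomputable def H : Matrix (Fin d) (Fin d) ℝ :=
  Matrix.of fun m j => (∫ b, b m ∂(M.markLaw j)) * M.c m j

/-- The stability condition: the spectral radius of `H` is smaller than one. -/
def Stable : Prop := spectralRadius ℂ (M.H.map (algebraMap ℝ ℂ)) < 1

/-- The marks have a finite moment generating function at some vector with positive entries. -/
def MarksLightTailed : Prop :=
  ∃ η : Fin d → ℝ, (∀ m, 0 < η m) ∧
    ∀ j, ∫⁻ b, ENNReal.ofReal (Real.exp (∑ m, b m * η m)) ∂(M.markLaw j) < ∞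

/-! ### The Hawkes process in its cluster representation

An individual (an event that is born or not) is labelled by `(a, p)`, where `a = (j, r)` stands for
the immigrant number `r` of component `j`, and `p` is the line of descent from that immigrant, most
recent birth first; the entry `(m, r)` stands for the child number `r` in component `m`. -/

/-- Labels of the potential events. -/
abbrev Label (d : ℕ) : Type := (Fin d × ℕ) × List (Fin d × ℕ)

/-- The component in which an event takes place. -/
def comp : Label d → Fin d
  | (a, []) => a.1
  | (_, q :: _) => q.1

/-- Given the marks `b` of a parent in component `j`, the numbers of children in the components
`m = 1, …, d` are independent, Poisson with means `b_m c_{mj}`. -/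
noncomputable def offspringKernel (j : Fin d) : Kernel (Fin d → ℝ) (Fin d → ℕ) where
  toFun b := Measure.pi fun m => poissonMeasure (b m * M.c m j).toNNReal
  measurable' := by
    refine Measure.measurable_of_measurable_coe _ fun s _ => ?_
    have h : ∀ b : Fin d → ℝ,
        (Measure.pi fun m => poissonMeasure (b m * M.c m j).toNNReal) s =
          ∑' k : s, ∏ m, poissonMeasure (b m * M.c m j).toNNReal {(k : Fin d → ℕ) m} := by
      intro b
      rw [← Measure.tsum_indicator_apply_singleton _ s (Set.to_countable s).measurableSet,
        tsum_subtype s fun k : Fin d → ℕ =>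
          ∏ m, poissonMeasure (b m * M.c m j).toNNReal {k m}]
      simp only [Measure.pi_singleton]
    simp only [h, poissonMeasure_singleton]
    fun_prop

instance (j : Fin d) : IsMarkovKernel (M.offspringKernel j) :=
  ⟨fun b => inferInstanceAs (IsProbabilityMeasure
    (Measure.pi fun m => poissonMeasure (b m * M.c m j).toNNReal))⟩

/-- The law of the time that elapses between the birth of a parent in component `j` and that of any
given child in component `m`: it has density `g_{mj} / c_{mj}` on `(0, ∞)`.  A Poisson number with
mean `b_m c_{mj}` of independent points with this law is the Poisson process on `(0, ∞)` with
intensity `b_m g_{mj}`.  If `c_{mj} = 0` there are almost surely no such children, and the value is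
a dummy. -/
noncomputable def delayLaw (m j : Fin d) : Measure ℝ :=
  if M.c m j = 0 then Measure.dirac 1 else
    (ENNReal.ofReal (M.c m j))⁻¹ •
      (volume.restrict (Set.Ioi 0)).withDensity fun v => ENNReal.ofReal (M.decay m j v)

instance (m j : Fin d) : IsProbabilityMeasure (M.delayLaw m j) := by
  unfold delayLaw
  split_ifs with h
  · infer_instance
  · have h0 : 0 ≤ᵐ[volume.restrict (Set.Ioi 0)] M.decay m j := by
      refine (ae_restrict_iff' measurableSet_Ioi).2 (ae_of_all _ fun v hv => ?_)
      exact M.decay_nonneg m j v (le_of_lt hv)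
    have hc : 0 < M.c m j :=
      lt_of_le_of_ne (integral_nonneg_of_ae h0) (Ne.symm h)
    refine ⟨?_⟩
    rw [Measure.smul_apply, withDensity_apply _ MeasurableSet.univ, Measure.restrict_univ,
      ← ofReal_integral_eq_lintegral_ofReal (M.decay_integrable m j) h0, smul_eq_mul]
    exact ENNReal.inv_mul_cancel (ENNReal.ofReal_pos.2 hc).ne' ENNReal.ofReal_ne_top

instance : IsProbabilityMeasure (expMeasure 1) := isProbabilityMeasure_expMeasure one_pos

/-- The sample space: for every `(j, r)` a standardized interarrival time of the immigrants, for
every individual its marks and its numbers of children, for every potential child the delay of its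
birth, and for every `(j, r)` the claim vector `U_{j,r}`. -/
abbrev Sample (d dstar : ℕ) : Type :=
  (Fin d × ℕ → ℝ) × (Label d → (Fin d → ℝ) × (Fin d → ℕ)) ×
    (Label d × Fin d × ℕ → ℝ) × (Fin d × ℕ → Fin dstar → ℝ)

/-- The probability measure under which all these random elements are independent, with the
prescribed laws. -/
noncomputable def prob : Measure (Sample d dstar) :=
  (Measure.infinitePi fun _ : Fin d × ℕ => expMeasure 1).prod <|
  (Measure.infinitePi fun ℓ : Label d =>
    (M.markLaw (comp ℓ)) ⊗ₘ (M.offspringKernel (comp ℓ))).prod <|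
  (Measure.infinitePi fun q : Label d × Fin d × ℕ => M.delayLaw q.2.1 (comp q.1)).prod <|
  Measure.infinitePi fun q : Fin d × ℕ => M.claimLaw q.1

/-- The individual with line of descent `p` from the immigrant `a` is born (if `a` is). -/
def Born (ω : Sample d dstar) (a : Fin d × ℕ) : List (Fin d × ℕ) → Prop
  | [] => True
  | q :: p => Born ω a p ∧ q.2 < (ω.2.1 (a, p)).2 q.1

/-- The time between the arrival of the immigrant `a` and the birth of the individual `(a, p)`. -/
def age (ω : Sample d dstar) (a : Fin d × ℕ) : List (Fin d × ℕ) → ℝ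
  | [] => 0
  | q :: p => age ω a p + ω.2.2.1 ((a, p), q)

/-- The arrival time of immigrant `a = (j, r)`: the sum of the first `r + 1` interarrival times,
which are exponential with parameter `rate j`.  It is used only if `rate j > 0`; a component with
`rate j = 0` has no immigrants. -/
noncomputable def arrival (ω : Sample d dstar) (a : Fin d × ℕ) : ℝ :=
  (∑ k ∈ Finset.range (a.2 + 1), ω.1 (a.1, k)) / M.rate a.1

/-- `N_i(t)`, the number of events in component `i` up to time `t` (almost surely finite under the
stability condition). -/
noncomputable def N (t : ℝ) (i : Fin d) (ω : Sample d dstar) : ℕ :=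
  Set.ncard {ℓ : Label d | 0 < M.rate ℓ.1.1 ∧ Born ω ℓ.1 ℓ.2 ∧ comp ℓ = i ∧
    M.arrival ω ℓ.1 + age ω ℓ.1 ℓ.2 ≤ t}

/-- The compound process `Z_i(t) = ∑_j ∑_{r ≤ N_j(t)} U_{ij,r}`. -/
noncomputable def Z (t : ℝ) (ω : Sample d dstar) (i : Fin dstar) : ℝ :=
  ∑ j, ∑ r ∈ Finset.range (M.N t j ω), ω.2.2.2 (j, r) i

/-- `m_{Z(t)}(θ) = E[exp(θᵀ Z(t))]`, with values in `[0, ∞]`. -/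
noncomputable def mgfZ (t : ℝ) (θ : Fin dstar → ℝ) : ℝ≥0∞ :=
  ∫⁻ ω, ENNReal.ofReal (Real.exp (θ ⬝ᵥ M.Z t ω)) ∂M.prob

/-- `S_{l←j}`, the total number of events in component `l` in the cluster of an immigrant of
component `j`, the immigrant included (almost surely finite under the stability condition).  The
cluster taken here is the one of the first immigrant; all clusters of immigrants of component `j`
have the same law. -/
noncomputable def clusterSize (j l : Fin d) (ω : Sample d dstar) : ℕ :=
  Set.ncard {p : List (Fin d × ℕ) | Born ω (j, 0) p ∧ comp ((j, 0), p) = l}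

/-- `f_j(z) = E[∏_l z_l ^ S_{l←j}]`, with values in `[0, ∞]`. -/
noncomputable def f (j : Fin d) (z : Fin d → ℝ≥0∞) : ℝ≥0∞ :=
  ∫⁻ ω, ∏ l, z l ^ clusterSize j l ω ∂M.prob

/-- `m_{U_j}(θ) = E[exp(θᵀ U_j)]`, with values in `[0, ∞]`. -/
noncomputable def mgfU (θ : Fin dstar → ℝ) (j : Fin d) : ℝ≥0∞ :=
  ∫⁻ v, ENNReal.ofReal (Real.exp (θ ⬝ᵥ v)) ∂(M.claimLaw j)

/-- `Λ(θ) = ∑_j rate_j (f_j(m_U(θ)) - 1)`, with values in `(-∞, ∞]`. -/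
noncomputable def Lam (θ : Fin dstar → ℝ) : EReal :=
  ∑ j, ((M.rate j : ℝ) : EReal) * ((M.f j (M.mgfU θ) : EReal) - 1)

/-- The domain of `Λ`. -/
def domain : Set (Fin dstar → ℝ) := {θ | M.Lam θ < ⊤}

/-- `E[exp(∑_m B_{mj} c_{mj} (x_m - 1))]`. -/
noncomputable def expMoment (x : Fin d → ℝ) (j : Fin d) : ℝ :=
  ∫ b, Real.exp (∑ m, b m * M.c m j * (x m - 1)) ∂(M.markLaw j)

/-- `E[B_{kj} c_{kj} exp(∑_m B_{mj} c_{mj} (x_m - 1))]`. -/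
noncomputable def expMomentDeriv (x : Fin d → ℝ) (k j : Fin d) : ℝ :=
  ∫ b, b k * M.c k j * Real.exp (∑ m, b m * M.c m j * (x m - 1)) ∂(M.markLaw j)

/-- `(z, x)` is the pair `(ẑ, x̂)` that belongs to the positive vector `r`: the expectations are
finite, `x` solves the system of equations and `z` is the resulting vector. -/
structure IsCritical (r x z : Fin d → ℝ) : Prop where
  r_pos : ∀ j, 0 < r j
  integrable_exp : ∀ j,
    Integrable (fun b => Real.exp (∑ m, b m * M.c m j * (x m - 1))) (M.markLaw j)
  integrable_deriv : ∀ k j,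
    Integrable (fun b => b k * M.c k j * Real.exp (∑ m, b m * M.c m j * (x m - 1)))
      (M.markLaw j)
  x_eq : ∀ j, x j * ∑ k, r k * M.expMomentDeriv x k j = r j * M.expMoment x j
  z_eq : ∀ j, z j = r j * (∑ k, r k * M.expMomentDeriv x k j)⁻¹

end HawkesModel

/-!
The proof rests on the recursive structure of the clusters. Write `x ≥ z E[x ^ litter]` for the
inequality `z_j E[∏_m x_m ^ k_m] ≤ x_j`, where `k` is the vector of the numbers of children of an
event in component `j`. For such a pair, the weight `∏ z` over the members of the first `n`
generations times `∏ x` over the members of generation `n` is a supermartingale in `n`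
(`lintegral_genWeight_le`), whose initial value is `x_j`. There are two consequences.

* If all `z_j` equal some `ζ > 1` and `1 ≤ x < ∞`, clusters are almost surely finite, because `n`
  nonempty generations would contribute a factor `ζ ^ n` (`ae_exists_gen_eq_empty`).
* If clusters are almost surely finite, then `f_j(z) ≤ x_j` by Fatou's lemma
  (`lintegral_prod_pow_ncard_le`).

Since the numbers of children are mixed Poisson, the expectation in the inequality is
`E[exp(∑_m B_{mj} c_{mj} (x_m - 1))]` (`lintegral_litter`). Stability gives a positive vector `v`
with `Hᵀ v < v`, and a first order expansion at `1` shows that `x = 1 + ε v` works with some `ζ > 1`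
(`exists_supersolution`). Hence clusters are almost surely finite, and `f_j(m_U(θ))` is finite as
soon as `m_U(θ) ≤ ζ`, which holds for all `θ` near the origin; this is the first part. For the
second part, `x̂` is a solution for the weights `ẑ`, so that `f_j(m_U(θ)) ≤ f_j(ẑ) ≤ x̂_j`.

For the limit, let `z = m_U(θ)` and `F_j(u) = E[∏_l z_l ^ S_{l←j}(u)]`, with the events of a cluster
up to the age `u`. Integrating out the claims, then the mutually independent clusters, and then the
Poisson arrivals of the immigrants (`lintegral_poisson_prod`) yields
`E[exp(θᵀ Z(t))] = ∏_j exp(rate_j ∫_0^t (F_j(u) - 1) du)` (`mgfZ_eq_prod`). As `F_j(u) → f_j(z)`, by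
dominated convergence with the dominating function `∏_l ẑ_l ^ S_{l←j}`, which exceeds the integrand
because `ẑ ≥ 1`, the time averages converge to `f_j(z) - 1`.
-/

/-! ### Product measures -/

theorem lintegral_finsetProd_infinitePi {ι : Type*} {X : ι → Type*} [∀ i, MeasurableSpace (X i)]
    (μ : ∀ i, Measure (X i)) [∀ i, IsProbabilityMeasure (μ i)] (s : Finset ι)
    (φ : ∀ i, X i → ℝ≥0∞) (hφ : ∀ i, Measurable (φ i)) :
    ∫⁻ ω, ∏ i ∈ s, φ i (ω i) ∂Measure.infinitePi μ = ∏ i ∈ s, ∫⁻ y, φ i y ∂μ i := by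
  refine (lintegral_prod_eq_prod_lintegral_of_indepFun s (fun i (ω : ∀ i, X i) => φ i (ω i))
    (iIndepFun_infinitePi hφ) (fun i => (hφ i).comp (measurable_pi_apply i))).trans ?_
  refine Finset.prod_congr rfl fun i _ => ?_
  rw [← Measure.infinitePi_map_eval μ i, lintegral_map (hφ i) (measurable_pi_apply i)]

/-- Disjoint blocks of coordinates are independent under a product measure. -/
theorem lintegral_finsetProd_blocks {A P X : Type*} [MeasurableSpace X]
    (ν : A × P → Measure X) [∀ i, IsProbabilityMeasure (ν i)] (s : Finset A)
    (φ : A → (P → X) → ℝ≥0∞) (hφ : ∀ a, Measurable (φ a)) :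
    ∫⁻ ω, ∏ a ∈ s, φ a (fun p => ω (a, p)) ∂Measure.infinitePi ν =
      ∏ a ∈ s, ∫⁻ y, φ a y ∂Measure.infinitePi fun p => ν (a, p) := by
  rw [← lintegral_finsetProd_infinitePi (fun a => Measure.infinitePi fun p => ν (a, p)) s φ hφ,
    ← Measure.infinitePi_map_curry fun a p => ν (a, p), lintegral_map _ (by fun_prop)]
  · rfl
  · fun_prop

/-- Resampling the coordinates outside of a set does not change a product measure. -/
theorem map_ite_infinitePi {ι : Type*} {X : ι → Type*} [∀ i, MeasurableSpace (X i)]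
    (μ : ∀ i, Measure (X i)) [∀ i, IsProbabilityMeasure (μ i)] (S : ι → Prop) [DecidablePred S] :
    ((Measure.infinitePi μ).prod (Measure.infinitePi μ)).map
      (fun w i => if S i then w.1 i else w.2 i) = Measure.infinitePi μ := by
  refine Measure.eq_infinitePi μ fun s t ht => ?_
  rw [Measure.map_apply]
  · have : (fun (w : (∀ i, X i) × (∀ i, X i)) i => if S i then w.1 i else w.2 i) ⁻¹'
        (s : Set ι).pi t =
        ((s.filter S : Finset ι) : Set ι).pi t ×ˢ
          ((s.filter fun i => ¬ S i : Finset ι) : Set ι).pi t := by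
      ext w
      simp only [Set.mem_preimage, Set.mem_pi, Finset.mem_coe, Set.mem_prod, Finset.mem_filter]
      constructor
      · intro h
        exact ⟨fun i hi => by simpa [hi.2] using h i hi.1,
          fun i hi => by simpa [hi.2] using h i hi.1⟩
      · intro h i hi
        by_cases hS : S i
        · simpa [hS] using h.1 i ⟨hi, hS⟩
        · simpa [hS] using h.2 i ⟨hi, hS⟩
    rw [this, Measure.prod_prod, Measure.infinitePi_pi _ fun i _ => ht i,
      Measure.infinitePi_pi _ fun i _ => ht i, Finset.prod_filter_mul_prod_filter_not]
  · refine measurable_pi_lambda _ fun i => ?_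
    by_cases hS : S i
    · simp only [hS, if_true]; fun_prop
    · simp only [hS, if_false]; fun_prop
  · exact MeasurableSet.pi s.countable_toSet fun i _ => ht i

theorem lintegral_infinitePi_eq_lintegral_ite {ι : Type*} {X : ι → Type*}
    [∀ i, MeasurableSpace (X i)] (μ : ∀ i, Measure (X i)) [∀ i, IsProbabilityMeasure (μ i)]
    (S : ι → Prop) [DecidablePred S] {φ : (∀ i, X i) → ℝ≥0∞} (hφ : Measurable φ) :
    ∫⁻ w, φ w ∂Measure.infinitePi μ =
      ∫⁻ w, ∫⁻ w', φ (fun i => if S i then w i else w' i) ∂Measure.infinitePi μ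
        ∂Measure.infinitePi μ := by
  have hm : Measurable fun (w : (∀ i, X i) × (∀ i, X i)) i => if S i then w.1 i else w.2 i := by
    refine measurable_pi_lambda _ fun i => ?_
    by_cases hS : S i
    · simp only [hS, if_true]; fun_prop
    · simp only [hS, if_false]; fun_prop
  conv_lhs => rw [← map_ite_infinitePi μ S]
  rw [lintegral_map hφ hm]
  exact lintegral_prod _ (hφ.comp hm).aemeasurable

/-- An i.i.d. sequence is an independent pair of its first term and its tail. -/
theorem lintegral_infinitePi_nat {X : Type*} [MeasurableSpace X] (μ : Measure X)
    [IsProbabilityMeasure μ] {φ : (ℕ → X) → ℝ≥0∞} (hφ : Measurable φ) :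
    ∫⁻ w, φ w ∂Measure.infinitePi (fun _ : ℕ => μ) =
      ∫⁻ x, ∫⁻ w, φ (fun n => Nat.casesOn n x w) ∂Measure.infinitePi (fun _ : ℕ => μ) ∂μ := by
  have hm : Measurable fun (w : X × (ℕ → X)) (n : ℕ) =>
      (Nat.casesOn n w.1 w.2 : X) := by
    refine measurable_pi_lambda _ fun n => ?_
    cases n with
    | zero => exact measurable_fst
    | succ n => exact (measurable_pi_apply n).comp measurable_snd
  have hmap : (μ.prod (Measure.infinitePi fun _ : ℕ => μ)).map
      (fun (w : X × (ℕ → X)) (n : ℕ) => (Nat.casesOn n w.1 w.2 : X)) =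
      Measure.infinitePi fun _ : ℕ => μ := by
    refine Measure.eq_infinitePi _ fun s t ht => ?_
    rw [Measure.map_apply hm (MeasurableSet.pi s.countable_toSet fun i _ => ht i)]
    have : (fun (w : X × (ℕ → X)) (n : ℕ) => (Nat.casesOn n w.1 w.2 : X)) ⁻¹'
        (s : Set ℕ).pi t =
        (if 0 ∈ s then t 0 else Set.univ) ×ˢ
          ((s.preimage Nat.succ (Nat.succ_injective.injOn) : Finset ℕ) : Set ℕ).pi
            fun n => t (n + 1) := by
      ext w
      simp only [Set.mem_preimage, Set.mem_pi, Finset.mem_coe, Set.mem_prod, Finset.mem_preimage]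
      constructor
      · intro h
        refine ⟨?_, fun i hi => h (i + 1) hi⟩
        split_ifs with h0
        · exact h 0 h0
        · trivial
      · rintro ⟨h0, h⟩ i hi
        cases i with
        | zero => simpa [hi] using h0
        | succ i => exact h i hi
    rw [this, Measure.prod_prod, Measure.infinitePi_pi _ fun i _ => ht (i + 1)]
    by_cases h0 : 0 ∈ s
    · rw [if_pos h0, ← Finset.mul_prod_erase s (fun i => μ (t i)) h0]
      congr 1
      rw [← Finset.prod_image (s := s.preimage Nat.succ Nat.succ_injective.injOn)
        (g := Nat.succ) (f := fun i => μ (t i)) Nat.succ_injective.injOn]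
      refine Finset.prod_congr ?_ fun _ _ => rfl
      ext i
      cases i <;> simp
    · rw [if_neg h0, measure_univ, one_mul,
        ← Finset.prod_image (s := s.preimage Nat.succ Nat.succ_injective.injOn)
        (g := Nat.succ) (f := fun i => μ (t i)) Nat.succ_injective.injOn]
      refine Finset.prod_congr ?_ fun _ _ => rfl
      ext i
      cases i <;> simp [h0]
  conv_lhs => rw [← hmap]
  rw [lintegral_map hφ hm]
  exact lintegral_prod _ (hφ.comp hm).aemeasurable

/-! ### Counting random sets -/

theorem measurable_ncard_setOf {Ω ι : Type*} [MeasurableSpace Ω] [Countable ι]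
    (P : Ω → ι → Prop) (hP : ∀ i, MeasurableSet {ω | P ω i}) :
    Measurable fun ω => Set.ncard {i | P ω i} := by
  have hpos : ∀ k : ℕ, k ≠ 0 → MeasurableSet {ω | Set.ncard {i | P ω i} = k} := by
    intro k hk
    have : {ω | Set.ncard {i | P ω i} = k} =
        ⋃ s : Finset ι, ⋃ _ : s.card = k, ⋂ i, {ω | P ω i ↔ i ∈ s} := by
      ext ω
      simp only [Set.mem_ofPred_eq, Set.mem_iUnion, Set.mem_iInter, exists_prop]
      constructor
      · intro h
        have hfin : {i | P ω i}.Finite := Set.finite_of_ncard_ne_zero (by rw [h]; exact hk)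
        refine ⟨hfin.toFinset, ?_, fun i => by simp⟩
        rw [← h, Set.ncard_eq_toFinset_card _ hfin]
      · rintro ⟨s, hs, h⟩
        have : {i | P ω i} = (s : Set ι) := by ext i; simp [h i]
        rw [this, Set.ncard_coe_finset, hs]
    rw [this]
    refine MeasurableSet.iUnion fun s => MeasurableSet.iUnion fun _ => MeasurableSet.iInter
      fun i => ?_
    by_cases hi : i ∈ s
    · simpa [hi] using hP i
    · simp only [hi, iff_false]
      exact (hP i).compl
  refine measurable_to_countable' fun k => ?_
  by_cases hk : k = 0
  · have : (fun ω => Set.ncard {i | P ω i}) ⁻¹' {k} =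
        (⋃ k : ℕ, ⋃ _ : k ≠ 0, {ω | Set.ncard {i | P ω i} = k})ᶜ := by
      ext ω
      simp only [hk, Set.mem_preimage, Set.mem_singleton_iff, Set.mem_compl_iff, Set.mem_iUnion,
        Set.mem_ofPred_eq, exists_prop, not_exists, not_and]
      exact ⟨fun h i hi h' => hi (h' ▸ h), fun h => by_contra fun h' => h _ h' rfl⟩
    rw [this]
    exact (MeasurableSet.iUnion fun k => MeasurableSet.iUnion fun h => hpos k h).compl
  · exact hpos k hk

theorem prod_pow_ncard_eq {α β R : Type*} [Fintype β] [CommMonoid R]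
    (z : β → R) (g : α → β) {P : α → Prop} {s : Finset α} (hs : ∀ a, P a ↔ a ∈ s) :
    ∏ l, z l ^ Set.ncard {a | P a ∧ g a = l} = ∏ a ∈ s, z (g a) := by
  classical
  rw [← Finset.prod_fiberwise' s g z]
  refine Finset.prod_congr rfl fun l _ => ?_
  rw [Finset.prod_const, ← Set.ncard_coe_finset]
  congr 2
  ext a
  simp [hs]

namespace HawkesModel

variable {d : ℕ}

/-! ### The family tree of one immigrant -/

/-- The marks and the numbers of children of the potential members of one cluster; the immigrant
has the label `[]`. -/
abbrev Litters (d : ℕ) : Type := List (Fin d × ℕ) → (Fin d → ℝ) × (Fin d → ℕ)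

/-- The component of the member `p` of the cluster of an immigrant in component `j`. -/
def kind (j : Fin d) (p : List (Fin d × ℕ)) : Fin d := comp ((j, 0), p)

/-- The member `p` of the cluster with litters `K` is born. -/
def TreeBorn (K : Litters d) : List (Fin d × ℕ) → Prop
  | [] => True
  | q :: p => TreeBorn K p ∧ q.2 < (K p).2 q.1

/-- The labels of the children of `p`. -/
def children (K : Litters d) (p : List (Fin d × ℕ)) : Finset (List (Fin d × ℕ)) :=
  (Finset.univ.sigma fun m => Finset.range ((K p).2 m)).image fun q => (q.1, q.2) :: p

/-- The `n`-th generation of a cluster. -/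
def gen (K : Litters d) : ℕ → Finset (List (Fin d × ℕ))
  | 0 => {[]}
  | n + 1 => (gen K n).biUnion (children K)

theorem mem_children {K : Litters d} {p p' : List (Fin d × ℕ)} :
    p' ∈ children K p ↔ ∃ q : Fin d × ℕ, q.2 < (K p).2 q.1 ∧ q :: p = p' := by
  simp only [children, Finset.mem_image, Finset.mem_sigma, Finset.mem_univ, true_and,
    Finset.mem_range]
  constructor
  · rintro ⟨q, h, rfl⟩
    exact ⟨(q.1, q.2), h, rfl⟩
  · rintro ⟨q, h, rfl⟩
    exact ⟨⟨q.1, q.2⟩, h, rfl⟩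

theorem mem_gen {K : Litters d} {n : ℕ} {p : List (Fin d × ℕ)} :
    p ∈ gen K n ↔ p.length = n ∧ TreeBorn K p := by
  induction n generalizing p with
  | zero =>
    simp only [gen, Finset.mem_singleton, List.length_eq_zero_iff]
    exact ⟨fun h => by subst h; exact ⟨rfl, trivial⟩, fun h => h.1⟩
  | succ n ih =>
    simp only [gen, Finset.mem_biUnion, mem_children, ih]
    constructor
    · rintro ⟨p', ⟨h1, h2⟩, q, hq, rfl⟩
      exact ⟨by simp [h1], h2, hq⟩
    · rintro ⟨h1, h2⟩
      cases p with
      | nil => simp at h1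
      | cons q p => exact ⟨p, ⟨by simpa using h1, h2.1⟩, q, h2.2, rfl⟩

theorem prod_children {R : Type*} [CommMonoid R] (j : Fin d) (K : Litters d) (x : Fin d → R)
    (p : List (Fin d × ℕ)) :
    ∏ p' ∈ children K p, x (kind j p') = ∏ m, x m ^ (K p).2 m := by
  rw [children, Finset.prod_image, Finset.prod_sigma]
  · refine Finset.prod_congr rfl fun m _ => ?_
    simp [kind, comp]
  · rintro ⟨m, i⟩ - ⟨m', i'⟩ - h
    simp only [List.cons.injEq, Prod.mk.injEq, and_true] at h
    obtain ⟨rfl, rfl⟩ := h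
    rfl

theorem prod_gen_succ {R : Type*} [CommMonoid R] (j : Fin d) (K : Litters d) (x : Fin d → R)
    (n : ℕ) :
    ∏ p ∈ gen K (n + 1), x (kind j p) = ∏ p ∈ gen K n, ∏ m, x m ^ (K p).2 m := by
  rw [gen, Finset.prod_biUnion]
  · exact Finset.prod_congr rfl fun p _ => prod_children j K x p
  · intro p _ p' _ hne
    refine Finset.disjoint_left.2 fun r hr hr' => hne ?_
    obtain ⟨q, -, rfl⟩ := mem_children.1 hr
    obtain ⟨q', -, h⟩ := mem_children.1 hr'
    exact (List.cons.inj h).2.symm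

theorem treeBorn_congr {K K' : Litters d} {p : List (Fin d × ℕ)}
    (h : ∀ p' : List (Fin d × ℕ), p'.length < p.length → K p' = K' p') :
    TreeBorn K p ↔ TreeBorn K' p := by
  induction p with
  | nil => exact Iff.rfl
  | cons q p ih =>
    simp only [TreeBorn]
    rw [ih fun p' hp' => h p' (by simp; omega), h p (by simp)]

theorem gen_congr {K K' : Litters d} {n : ℕ}
    (h : ∀ p : List (Fin d × ℕ), p.length < n → K p = K' p) : gen K n = gen K' n := by
  ext p
  rw [mem_gen, mem_gen]
  exact and_congr_right fun hp => treeBorn_congr fun p' hp' => h p' (hp ▸ hp')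

theorem measurableSet_treeBorn {Ω : Type*} [MeasurableSpace Ω] {K : Ω → Litters d}
    (hK : Measurable K) (p : List (Fin d × ℕ)) : MeasurableSet {ω | TreeBorn (K ω) p} := by
  induction p with
  | nil => exact MeasurableSet.univ
  | cons q p ih =>
    refine ih.inter (?_ : MeasurableSet {ω | q.2 < (K ω p).2 q.1})
    exact measurableSet_lt measurable_const (by fun_prop)

theorem measurable_prod_gen (n : ℕ) (y : List (Fin d × ℕ) → ℝ≥0∞) :
    Measurable fun K : Litters d => ∏ p ∈ gen K n, y p := by
  have : Measurable[_, ⊤] fun K : Litters d => gen K n := by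
    refine @measurable_to_countable' _ _ ⊤ _ _ _ fun s => ?_
    have : (fun K : Litters d => gen K n) ⁻¹' {s} = ⋂ p, {K | p ∈ gen K n ↔ p ∈ s} := by
      ext K
      simp [Finset.ext_iff]
    rw [this]
    refine MeasurableSet.iInter fun p => ?_
    have hp : MeasurableSet {K : Litters d | p ∈ gen K n} := by
      simp only [mem_gen]
      by_cases hl : p.length = n
      · simpa [hl] using measurableSet_treeBorn measurable_id p
      · simp [hl]
    by_cases hi : p ∈ s
    · simpa [hi] using hp
    · simp only [hi, iff_false]
      exact hp.compl
  exact (measurable_from_top (f := fun s : Finset (List (Fin d × ℕ)) => ∏ p ∈ s, y p)).comp this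

/-! ### Multiplicative supermartingales along the generations -/

/-- The law of the litters of a cluster with root in component `j`, if a member in component `i`
has a litter with law `Q i`. -/
noncomputable def litterLaw (Q : Fin d → Measure ((Fin d → ℝ) × (Fin d → ℕ))) (j : Fin d) :
    Measure (Litters d) :=
  Measure.infinitePi fun p => Q (kind j p)

section

variable (Q : Fin d → Measure ((Fin d → ℝ) × (Fin d → ℕ))) [∀ i, IsProbabilityMeasure (Q i)]

instance (j : Fin d) : IsProbabilityMeasure (litterLaw Q j) := by
  unfold litterLaw
  infer_instance

/-- The weight `z` for every member of the generations before the `n`-th, and the weight `x` for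
every member of the `n`-th generation. -/
noncomputable def genWeight (z x : Fin d → ℝ≥0∞) (j : Fin d) (n : ℕ) (K : Litters d) : ℝ≥0∞ :=
  (∏ i ∈ Finset.range n, ∏ p ∈ gen K i, z (kind j p)) * ∏ p ∈ gen K n, x (kind j p)

theorem measurable_genWeight (z x : Fin d → ℝ≥0∞) (j : Fin d) (n : ℕ) :
    Measurable (genWeight z x j n) := by
  unfold genWeight
  exact (Finset.measurable_fun_prod _ fun i _ => measurable_prod_gen i _).mul
    (measurable_prod_gen n _)

/-- If `x` is a supersolution of the equation `x = z E[x ^ litter]`, then `genWeight` is a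
supermartingale: given the first `n` generations, the litters of the `n`-th one are independent. -/
theorem lintegral_genWeight_le {z x : Fin d → ℝ≥0∞}
    (h : ∀ i, z i * ∫⁻ k, ∏ m, x m ^ k.2 m ∂Q i ≤ x i) (j : Fin d) (n : ℕ) :
    ∫⁻ K, genWeight z x j n K ∂litterLaw Q j ≤ x j := by
  induction n with
  | zero => simp [genWeight, gen, kind, comp]
  | succ n ih =>
    refine le_trans ?_ ih
    rw [litterLaw, lintegral_infinitePi_eq_lintegral_ite _ (fun p => p.length < n)
      (measurable_genWeight z x j (n + 1))]
    refine lintegral_mono fun K => ?_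
    have hgen : ∀ (K' : Litters d) (i : ℕ), i ≤ n →
        gen (fun p => if p.length < n then K p else K' p) i = gen K i := fun K' i hi =>
      gen_congr fun p hp => if_pos (hp.trans_le hi)
    have hW : ∀ K' : Litters d,
        genWeight z x j (n + 1) (fun p => if p.length < n then K p else K' p) =
          (∏ i ∈ Finset.range n, ∏ p ∈ gen K i, z (kind j p)) *
            ∏ p ∈ gen K n, z (kind j p) * ∏ m, x m ^ (K' p).2 m := by
      intro K'
      rw [genWeight, prod_gen_succ, Finset.prod_range_succ, hgen K' n le_rfl, mul_assoc,
        ← Finset.prod_mul_distrib]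
      congr 1
      · exact Finset.prod_congr rfl fun i hi => by rw [hgen K' i (Finset.mem_range.1 hi).le]
      · refine Finset.prod_congr rfl fun p hp => ?_
        rw [if_neg (by rw [(mem_gen.1 hp).1]; exact lt_irrefl n)]
    have hm : Measurable fun k : (Fin d → ℝ) × (Fin d → ℕ) => ∏ m, x m ^ k.2 m :=
      Finset.measurable_fun_prod _ fun m _ =>
        (measurable_from_top (f := fun k : ℕ => x m ^ k)).comp
          ((measurable_pi_apply m).comp measurable_snd)
    simp only [hW]
    rw [lintegral_const_mul, lintegral_finsetProd_infinitePi (fun p => Q (kind j p)) (gen K n)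
      (fun p k => z (kind j p) * ∏ m, x m ^ k.2 m) fun p => hm.const_mul _]
    · rw [genWeight]
      gcongr with p hp
      rw [lintegral_const_mul _ hm]
      exact h _
    · exact Finset.measurable_fun_prod _ fun p _ =>
        (hm.comp (measurable_pi_apply p)).const_mul _

theorem gen_eq_empty_of_le {K : Litters d} {n i : ℕ} (h : gen K n = ∅) (hi : n ≤ i) :
    gen K i = ∅ := by
  induction i, hi using Nat.le_induction with
  | base => exact h
  | succ i _ ih => rw [gen, ih]; rfl

/-- A finite weight `ζ > 1` per member that admits a finite supersolution rules out that a cluster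
survives for ever, since `n` generations contribute a factor `ζ ^ n` at least. -/
theorem ae_exists_gen_eq_empty {ζ : ℝ≥0∞} {x : Fin d → ℝ≥0∞} (hζ : 1 < ζ)
    (hx1 : ∀ i, 1 ≤ x i) (hx : ∀ i, x i ≠ ∞)
    (h : ∀ i, ζ * ∫⁻ k, ∏ m, x m ^ k.2 m ∂Q i ≤ x i) (j : Fin d) :
    ∀ᵐ K ∂litterLaw Q j, ∃ n, gen K n = ∅ := by
  set S : Set (Litters d) := {K | ¬ ∃ n, gen K n = ∅} with hS
  change litterLaw Q j S = 0
  have hle : ∀ n : ℕ, ζ ^ n * litterLaw Q j S ≤ x j := by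
    intro n
    refine le_trans ?_ (lintegral_genWeight_le Q (z := fun _ => ζ) h j n)
    refine le_trans ?_ (mul_meas_ge_le_lintegral
      (measurable_genWeight (fun _ => ζ) x j n) (ζ ^ n))
    gcongr
    intro K hK
    have hK' : ∀ i, gen K i ≠ ∅ := fun i hi => hK ⟨i, hi⟩
    change ζ ^ n ≤ genWeight (fun _ => ζ) x j n K
    have h1 : ζ ^ n ≤ ∏ i ∈ Finset.range n, ∏ p ∈ gen K i, ζ := by
      calc ζ ^ n = ∏ i ∈ Finset.range n, ζ := by simp
        _ ≤ _ := by
          gcongr with i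
          rw [Finset.prod_const]
          exact le_self_pow₀ hζ.le
            (Finset.card_ne_zero.2 (Finset.nonempty_iff_ne_empty.2 (hK' i)))
    have h2 : 1 ≤ ∏ p ∈ gen K n, x (kind j p) := Finset.one_le_prod' fun p _ => hx1 _
    calc ζ ^ n = ζ ^ n * 1 := (mul_one _).symm
      _ ≤ _ := by unfold genWeight; gcongr
  by_contra hne
  have ht : Tendsto (fun n : ℕ => ζ ^ n * litterLaw Q j S) atTop (𝓝 (∞ * litterLaw Q j S)) :=
    ENNReal.Tendsto.mul_const (ENNReal.tendsto_pow_atTop_nhds_top_iff.2 hζ)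
      (Or.inl ENNReal.top_ne_zero)
  rw [ENNReal.top_mul hne] at ht
  exact hx j (top_le_iff.1 (le_of_tendsto' ht hle))

theorem exists_finset_treeBorn {K : Litters d} (h : ∃ n, gen K n = ∅) :
    ∃ s : Finset (List (Fin d × ℕ)), (∀ p, TreeBorn K p ↔ p ∈ s) ∧
      ∀ (z x : Fin d → ℝ≥0∞) (j : Fin d), ∀ᶠ i in atTop,
        genWeight z x j i K = ∏ p ∈ s, z (kind j p) := by
  obtain ⟨n, hn⟩ := h
  have hmem : ∀ p, TreeBorn K p ↔ p ∈ (Finset.range n).biUnion (gen K) := by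
    intro p
    simp only [Finset.mem_biUnion, Finset.mem_range, mem_gen]
    refine ⟨fun hp => ⟨p.length, ?_, rfl, hp⟩, fun ⟨_, _, _, hp⟩ => hp⟩
    by_contra hlt
    have : p ∈ gen K p.length := mem_gen.2 ⟨rfl, hp⟩
    rw [gen_eq_empty_of_le hn (not_lt.1 hlt)] at this
    simp at this
  refine ⟨_, hmem, fun z x j => eventually_atTop.2 ⟨n, fun i hi => ?_⟩⟩
  rw [genWeight, gen_eq_empty_of_le hn hi, Finset.prod_empty, mul_one, Finset.prod_biUnion]
  · refine (Finset.prod_subset (Finset.range_subset_range.2 hi) fun k _ hk => ?_).symm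
    rw [gen_eq_empty_of_le hn (by simpa using hk), Finset.prod_empty]
  · intro a _ b _ hab
    refine Finset.disjoint_left.2 fun p hp hp' => hab ?_
    rw [← (mem_gen.1 hp).1, ← (mem_gen.1 hp').1]

theorem measurable_prod_pow_ncard {Ω ι : Type*} [MeasurableSpace Ω] [Countable ι]
    (z : Fin d → ℝ≥0∞) (P : Fin d → Ω → ι → Prop) (hP : ∀ l i, MeasurableSet {ω | P l ω i}) :
    Measurable fun ω => ∏ l, z l ^ Set.ncard {i | P l ω i} :=
  Finset.measurable_fun_prod _ fun l _ =>
    (measurable_from_top (f := fun k : ℕ => z l ^ k)).comp (measurable_ncard_setOf _ (hP l))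

/-- The generating function of the total progeny is dominated by every supersolution. -/
theorem lintegral_prod_pow_ncard_le {z x : Fin d → ℝ≥0∞}
    (h : ∀ i, z i * ∫⁻ k, ∏ m, x m ^ k.2 m ∂Q i ≤ x i) (j : Fin d)
    (hfin : ∀ᵐ K ∂litterLaw Q j, ∃ n, gen K n = ∅) :
    ∫⁻ K, ∏ l, z l ^ Set.ncard {p | TreeBorn K p ∧ kind j p = l} ∂litterLaw Q j ≤ x j := by
  calc _ = ∫⁻ K, liminf (fun n => genWeight z x j n K) atTop ∂litterLaw Q j := by
        refine lintegral_congr_ae ?_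
        filter_upwards [hfin] with K hK
        obtain ⟨s, hs, hw⟩ := exists_finset_treeBorn hK
        rw [prod_pow_ncard_eq z (kind j) hs]
        exact (tendsto_const_nhds.congr' ((hw z x j).mono fun _ h => h.symm)).liminf_eq.symm
    _ ≤ liminf (fun n => ∫⁻ K, genWeight z x j n K ∂litterLaw Q j) atTop :=
        lintegral_liminf_le fun n => measurable_genWeight z x j n
    _ ≤ x j := by
        refine liminf_le_of_le ?_ fun b hb => ?_
        · isBoundedDefault
        · obtain ⟨n, hn⟩ := hb.exists
          exact hn.trans (lintegral_genWeight_le Q h j n)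

end

/-! ### The law of a litter -/

theorem lintegral_pow_poissonMeasure (r : ℝ≥0) {x : ℝ} (hx : 0 ≤ x) :
    ∫⁻ k, ENNReal.ofReal x ^ k ∂poissonMeasure r = ENNReal.ofReal (Real.exp (r * (x - 1))) := by
  rw [lintegral_countable']
  have h : HasSum (fun k : ℕ => Real.exp (-r) * ((r * x) ^ k / k.factorial))
      (Real.exp (r * (x - 1))) := by
    have := (NormedSpace.expSeries_div_hasSum_exp (𝔸 := ℝ) ((r : ℝ) * x)).mul_left (Real.exp (-r))
    rw [← Real.exp_eq_exp_ℝ, ← Real.exp_add] at this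
    rwa [show -(r : ℝ) + r * x = r * (x - 1) by ring] at this
  rw [← h.tsum_eq, ENNReal.ofReal_tsum_of_nonneg (fun k => by positivity) h.summable]
  refine tsum_congr fun k => ?_
  rw [poissonMeasure_singleton, ← ENNReal.ofReal_pow hx, ← ENNReal.ofReal_mul (by positivity)]
  congr 1
  rw [mul_pow]
  ring

variable {dstar : ℕ} (M : HawkesModel d dstar)

theorem c_nonneg (m j : Fin d) : 0 ≤ M.c m j :=
  setIntegral_nonneg measurableSet_Ioi fun v hv => M.decay_nonneg m j v (le_of_lt hv)

/-- The joint law of the marks and of the numbers of children of an event in component `j`. -/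
noncomputable def litter (j : Fin d) : Measure ((Fin d → ℝ) × (Fin d → ℕ)) :=
  M.markLaw j ⊗ₘ M.offspringKernel j

instance (j : Fin d) : IsProbabilityMeasure (M.litter j) := by
  unfold litter
  infer_instance

theorem lintegral_litter (j : Fin d) {x : Fin d → ℝ} (hx : ∀ m, 0 ≤ x m) :
    ∫⁻ k, ∏ m, ENNReal.ofReal (x m) ^ k.2 m ∂M.litter j =
      ∫⁻ b, ENNReal.ofReal (Real.exp (∑ m, b m * M.c m j * (x m - 1))) ∂M.markLaw j := by
  have hm : Measurable fun k : (Fin d → ℝ) × (Fin d → ℕ) => ∏ m, ENNReal.ofReal (x m) ^ k.2 m :=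
    Finset.measurable_fun_prod _ fun m _ =>
      (measurable_from_top (f := fun k : ℕ => ENNReal.ofReal (x m) ^ k)).comp
        ((measurable_pi_apply m).comp measurable_snd)
  rw [litter, Measure.lintegral_compProd hm]
  refine lintegral_congr_ae ?_
  filter_upwards [M.markLaw_nonneg j] with b hb
  change ∫⁻ k, ∏ m, ENNReal.ofReal (x m) ^ k m
    ∂(Measure.pi fun m => poissonMeasure (b m * M.c m j).toNNReal) = _
  rw [← Measure.infinitePi_eq_pi, lintegral_finsetProd_infinitePi _ Finset.univ
    (fun m k => ENNReal.ofReal (x m) ^ k) fun m => measurable_from_top, Real.exp_sum,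
    ENNReal.ofReal_prod_of_nonneg fun m _ => (Real.exp_pos _).le]
  refine Finset.prod_congr rfl fun m _ => ?_
  rw [lintegral_pow_poissonMeasure _ (hx m),
    Real.coe_toNNReal _ (mul_nonneg (hb m) (M.c_nonneg m j))]

/-! ### A strict supersolution near the vector of ones -/

open scoped Matrix.Norms.Operator in
theorem tendsto_norm_pow_zero_of_spectralRadius_lt_one (A : Matrix (Fin d) (Fin d) ℂ)
    (hA : spectralRadius ℂ A < 1) : Tendsto (fun n : ℕ => ‖A ^ n‖) atTop (𝓝 0) := by
  obtain ⟨ρ, h1, h2⟩ := ENNReal.lt_iff_exists_nnreal_btwn.1 hA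
  have hg := spectrum.pow_nnnorm_pow_one_div_tendsto_nhds_spectralRadius A
  have hρ : ρ < 1 := by exact_mod_cast h2
  refine squeeze_zero' (Eventually.of_forall fun n => norm_nonneg _) ?_
    (tendsto_pow_atTop_nhds_zero_of_lt_one ρ.2 hρ)
  filter_upwards [hg.eventually (gt_mem_nhds h1), eventually_gt_atTop 0] with n hn hn0
  have hn' : (0 : ℝ) < n := by exact_mod_cast hn0
  have := ENNReal.rpow_le_rpow hn.le hn'.le
  rw [← ENNReal.rpow_mul, one_div, inv_mul_cancel₀ hn'.ne', ENNReal.rpow_one,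
    ENNReal.rpow_natCast] at this
  exact_mod_cast this

open scoped Matrix.Norms.Operator in
/-- The vector is a partial sum of the Neumann series of `(1 - Hᵀ)⁻¹` applied to the vector of
ones. -/
theorem exists_vecMul_lt {H : Matrix (Fin d) (Fin d) ℝ} (hH : ∀ m j, 0 ≤ H m j)
    (hr : spectralRadius ℂ (H.map (algebraMap ℝ ℂ)) < 1) :
    ∃ v : Fin d → ℝ, (∀ j, 0 < v j) ∧ ∀ j, ∑ m, v m * H m j < v j := by
  have hpow : ∀ n m j, 0 ≤ (H ^ n) m j := by
    intro n
    induction n with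
    | zero => intro m j; rw [pow_zero, Matrix.one_apply]; split_ifs <;> norm_num
    | succ n ih =>
      intro m j
      rw [pow_succ, Matrix.mul_apply]
      exact Finset.sum_nonneg fun k _ => mul_nonneg (ih m k) (hH k j)
  have ht := (tendsto_norm_pow_zero_of_spectralRadius_lt_one _ hr).const_mul (d : ℝ)
  rw [mul_zero] at ht
  obtain ⟨N, hN⟩ := (ht.eventually (gt_mem_nhds one_pos)).exists
  have hcol : ∀ j, ∑ m, (H ^ N) m j < 1 := by
    intro j
    refine lt_of_le_of_lt ?_ hN
    have : ∀ m, (H ^ N) m j ≤ ‖(H.map (algebraMap ℝ ℂ)) ^ N‖ := by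
      intro m
      have h1 : ‖((H.map (algebraMap ℝ ℂ)) ^ N) m j‖ ≤ ‖(H.map (algebraMap ℝ ℂ)) ^ N‖ := by
        have h := (norm_le_pi_norm _ m).trans
          (Matrix.linfty_opNorm_mulVec ((H.map (algebraMap ℝ ℂ)) ^ N) (Pi.single j 1))
        rw [Matrix.mulVec_single_one, Pi.norm_single, norm_one, mul_one] at h
        exact h
      have h2 : (H.map (algebraMap ℝ ℂ)) ^ N = (H ^ N).map (algebraMap ℝ ℂ) :=
        (map_pow (algebraMap ℝ ℂ).mapMatrix H N).symm
      rw [h2, Matrix.map_apply] at h1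
      rw [h2]
      refine le_trans ?_ h1
      simp [le_abs_self]
    calc ∑ m, (H ^ N) m j ≤ ∑ _m : Fin d, ‖(H.map (algebraMap ℝ ℂ)) ^ N‖ :=
          Finset.sum_le_sum fun m _ => this m
      _ = _ := by simp
  set v : Fin d → ℝ := fun j => ∑ n ∈ Finset.range N, ∑ m, (H ^ n) m j with hv
  have hvH : ∀ j, ∑ m, v m * H m j = v j - 1 + ∑ m, (H ^ N) m j := by
    intro j
    have h1 : ∑ m, v m * H m j = ∑ n ∈ Finset.range N, ∑ m, (H ^ (n + 1)) m j := by
      simp only [hv, Finset.sum_mul]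
      rw [Finset.sum_comm]
      refine Finset.sum_congr rfl fun n _ => ?_
      rw [Finset.sum_comm]
      refine Finset.sum_congr rfl fun m _ => ?_
      rw [pow_succ, Matrix.mul_apply]
    have h2 := Finset.sum_range_succ' (fun n => ∑ m, (H ^ n) m j) N
    rw [Finset.sum_range_succ] at h2
    have h3 : ∑ m, (H ^ 0) m j = 1 := by simp [Matrix.one_apply]
    rw [h1]
    simp only [hv]
    linarith
  have hv0 : ∀ j, 0 ≤ v j := fun j =>
    Finset.sum_nonneg fun n _ => Finset.sum_nonneg fun m _ => hpow n m j
  have hlt : ∀ j, ∑ m, v m * H m j < v j := fun j => by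
    rw [hvH j]; linarith [hcol j]
  exact ⟨v, fun j => lt_of_le_of_lt
    (Finset.sum_nonneg fun m _ => mul_nonneg (hv0 m) (hH m j)) (hlt j), hlt⟩

/-- For a nonnegative random variable with an exponential moment, `0` is interior to the domain of
the moment generating function. -/
theorem zero_mem_interior_integrableExpSet {Ω : Type*} [MeasurableSpace Ω] {μ : Measure Ω}
    [IsFiniteMeasure μ] {Y : Ω → ℝ} (hY : AEMeasurable Y μ) (h0 : ∀ᵐ ω ∂μ, 0 ≤ Y ω)
    {t : ℝ} (ht : 0 < t) (hint : Integrable (fun ω => Real.exp (t * Y ω)) μ) :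
    0 ∈ interior (integrableExpSet Y μ) := by
  refine mem_interior.2 ⟨Set.Iio t, fun s hs => ?_, isOpen_Iio, ht⟩
  refine hint.mono' (by fun_prop) ?_
  filter_upwards [h0] with ω hω
  rw [Real.norm_eq_abs, abs_of_pos (Real.exp_pos _)]
  exact Real.exp_le_exp.2 (mul_le_mul_of_nonneg_right (le_of_lt hs) hω)

/-- A weighted sum of the coordinates of a nonnegative random vector has an exponential moment if
the vector has one in a positive direction. -/
theorem exists_integrable_exp_of_lintegral_lt_top {n : ℕ} {μ : Measure (Fin n → ℝ)}
    (h0 : ∀ᵐ b ∂μ, ∀ m, 0 ≤ b m) {η : Fin n → ℝ} (hη : ∀ m, 0 < η m)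
    (hint : ∫⁻ b, ENNReal.ofReal (Real.exp (∑ m, b m * η m)) ∂μ < ∞) (w : Fin n → ℝ) :
    ∃ t : ℝ, 0 < t ∧ Integrable (fun b => Real.exp (t * ∑ m, b m * w m)) μ := by
  have hev : ∀ᶠ t : ℝ in 𝓝[>] 0, ∀ m, t * w m < η m := by
    refine eventually_all.2 fun m => ?_
    have : Tendsto (fun t : ℝ => t * w m) (𝓝[>] 0) (𝓝 (0 * w m)) :=
      ((continuous_id.mul continuous_const).tendsto 0).mono_left nhdsWithin_le_nhds
    rw [zero_mul] at this
    exact this.eventually (gt_mem_nhds (hη m))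
  obtain ⟨t, ht, htpos⟩ := (hev.and self_mem_nhdsWithin).exists
  refine ⟨t, htpos, ?_⟩
  have hI : Integrable (fun b : Fin n → ℝ => Real.exp (∑ m, b m * η m)) μ := by
    refine ⟨Measurable.aestronglyMeasurable (by fun_prop), ?_⟩
    rw [hasFiniteIntegral_iff_ofReal (ae_of_all _ fun _ => (Real.exp_pos _).le)]
    exact hint
  refine hI.mono' (Measurable.aestronglyMeasurable (by fun_prop)) ?_
  filter_upwards [h0] with b hb
  rw [Real.norm_eq_abs, abs_of_pos (Real.exp_pos _), Finset.mul_sum]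
  refine Real.exp_le_exp.2 (Finset.sum_le_sum fun m _ => ?_)
  calc t * (b m * w m) = b m * (t * w m) := by ring
    _ ≤ b m * η m := mul_le_mul_of_nonneg_left (ht m).le (hb m)

/-- Stability and light tails yield a finite supersolution with a constant weight `ζ > 1`: by a
first order expansion of the exponential moments, `x = 1 + ε v` works for small `ε` if `Hᵀ v < v`. -/
theorem exists_supersolution (hstable : M.Stable) (hmarks : M.MarksLightTailed) :
    ∃ (ζ : ℝ) (x : Fin d → ℝ), 1 < ζ ∧ (∀ i, 1 ≤ x i) ∧
      ∀ i, ENNReal.ofReal ζ * ∫⁻ k, ∏ m, ENNReal.ofReal (x m) ^ k.2 m ∂M.litter i ≤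
        ENNReal.ofReal (x i) := by
  obtain ⟨η, hη, hint⟩ := hmarks
  have hH : ∀ m j, 0 ≤ M.H m j := fun m j => mul_nonneg
    (integral_nonneg_of_ae ((M.markLaw_nonneg j).mono fun b hb => hb m)) (M.c_nonneg m j)
  obtain ⟨v, hv, hvH⟩ := exists_vecMul_lt hH hstable
  set Y : Fin d → (Fin d → ℝ) → ℝ := fun j b => ∑ m, b m * (M.c m j * v m) with hYdef
  have hYint : ∀ j, 0 ∈ interior (integrableExpSet (Y j) (M.markLaw j)) := by
    intro j
    obtain ⟨t, ht, htI⟩ := exists_integrable_exp_of_lintegral_lt_top (M.markLaw_nonneg j) hη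
      (hint j) fun m => M.c m j * v m
    refine zero_mem_interior_integrableExpSet (by fun_prop) ?_ ht htI
    filter_upwards [M.markLaw_nonneg j] with b hb
    exact Finset.sum_nonneg fun m _ => mul_nonneg (hb m) (mul_nonneg (M.c_nonneg m j) (hv m).le)
  have hBint : ∀ j m, Integrable (fun b : Fin d → ℝ => b m) (M.markLaw j) := by
    intro j m
    obtain ⟨t, ht, htI⟩ := exists_integrable_exp_of_lintegral_lt_top (M.markLaw_nonneg j) hη
      (hint j) (Pi.single m 1)
    have h0 := zero_mem_interior_integrableExpSet (Y := fun b : Fin d → ℝ => b m)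
      (μ := M.markLaw j) (measurable_pi_apply m).aemeasurable
      ((M.markLaw_nonneg j).mono fun b hb => hb m) ht
      (by simpa [Pi.single_apply] using htI)
    simpa using integrable_pow_of_mem_interior_integrableExpSet h0 1
  have hmean : ∀ j, (M.markLaw j)[Y j] < v j := by
    intro j
    refine lt_of_eq_of_lt ?_ (hvH j)
    rw [hYdef]
    simp only
    rw [integral_finsetSum _ fun m _ => (hBint j m).mul_const _]
    refine Finset.sum_congr rfl fun m _ => ?_
    rw [integral_mul_const]
    simp only [H, Matrix.of_apply]
    ring
  have hev : ∀ᶠ ε : ℝ in 𝓝[>] 0, ∀ j, mgf (Y j) (M.markLaw j) ε < 1 + ε * v j := by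
    refine eventually_all.2 fun j => ?_
    have hd := (hasDerivAt_mgf (hYint j)).tendsto_slope_zero_right
    simp only [zero_mul, Real.exp_zero, mul_one, zero_add, mgf_zero, smul_eq_mul] at hd
    filter_upwards [hd.eventually (gt_mem_nhds (hmean j)), self_mem_nhdsWithin] with ε h1 h2
    have h2' : (0 : ℝ) < ε := h2
    rw [inv_mul_lt_iff₀ h2'] at h1
    linarith
  have hI : ∀ᶠ ε : ℝ in 𝓝[>] 0, ∀ j, ε ∈ integrableExpSet (Y j) (M.markLaw j) :=
    eventually_all.2 fun j => nhdsWithin_le_nhds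
      (mem_interior_iff_mem_nhds.1 (hYint j))
  obtain ⟨ε, ⟨hε, hεI⟩, hεpos⟩ := ((hev.and hI).and self_mem_nhdsWithin).exists
  have hεpos : (0 : ℝ) < ε := hεpos
  have hζ : ∀ᶠ ζ : ℝ in 𝓝[>] 1, ∀ j, ζ * mgf (Y j) (M.markLaw j) ε < 1 + ε * v j := by
    refine eventually_all.2 fun j => ?_
    have : Tendsto (fun ζ : ℝ => ζ * mgf (Y j) (M.markLaw j) ε) (𝓝[>] 1)
        (𝓝 (1 * mgf (Y j) (M.markLaw j) ε)) :=
      ((continuous_id.mul continuous_const).tendsto 1).mono_left nhdsWithin_le_nhds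
    rw [one_mul] at this
    exact this.eventually (gt_mem_nhds (hε j))
  obtain ⟨ζ, hζ, hζ1⟩ := (hζ.and self_mem_nhdsWithin).exists
  have hζ1 : (1 : ℝ) < ζ := hζ1
  refine ⟨ζ, fun j => 1 + ε * v j, hζ1, fun i => by nlinarith [hv i], fun i => ?_⟩
  rw [M.lintegral_litter i fun m => by nlinarith [hv m]]
  have : ∫⁻ b, ENNReal.ofReal (Real.exp (∑ m, b m * M.c m i * (1 + ε * v m - 1))) ∂M.markLaw i =
      ENNReal.ofReal (mgf (Y i) (M.markLaw i) ε) := by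
    rw [mgf, ofReal_integral_eq_lintegral_ofReal (hεI i)
      (ae_of_all _ fun _ => (Real.exp_pos _).le)]
    refine lintegral_congr fun b => ?_
    congr 2
    rw [hYdef]
    simp only [Finset.mul_sum]
    exact Finset.sum_congr rfl fun m _ => by ring
  rw [this, ← ENNReal.ofReal_mul (by linarith)]
  exact ENNReal.ofReal_le_ofReal (hζ i).le

/-- A solution `x` of the critical system is a solution of `x = z E[x ^ litter]`. -/
theorem IsCritical.supersolution {r x z : Fin d → ℝ} (h : M.IsCritical r x z)
    (hz : ∀ j, 1 ≤ z j) (i : Fin d) :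
    ENNReal.ofReal (z i) * ∫⁻ k, ∏ m, ENNReal.ofReal (x m) ^ k.2 m ∂M.litter i ≤
      ENNReal.ofReal (x i) := by
  have hx : ∀ j, x j = z j * M.expMoment x j := by
    intro j
    have h1 := h.z_eq j
    have hne : ∑ k, r k * M.expMomentDeriv x k j ≠ 0 := by
      intro h0
      rw [h0, inv_zero, mul_zero] at h1
      linarith [hz j]
    have h2 := h.x_eq j
    rw [h1, mul_right_comm, ← h2, mul_inv_cancel_right₀ hne]
  have hx0 : ∀ j, 0 ≤ x j := fun j => by
    rw [hx j]
    exact mul_nonneg (by linarith [hz j]) (integral_nonneg fun _ => (Real.exp_pos _).le)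
  rw [M.lintegral_litter i hx0, ← ofReal_integral_eq_lintegral_ofReal (h.integrable_exp i)
    (ae_of_all _ fun _ => (Real.exp_pos _).le), ← ENNReal.ofReal_mul (by linarith [hz i])]
  exact ENNReal.ofReal_le_ofReal (hx i).ge

/-! ### A functional of the unit rate Poisson process -/

theorem lintegral_expMeasure_one {φ : ℝ → ℝ≥0∞} (hφ : Measurable φ) :
    ∫⁻ x, φ x ∂expMeasure 1 = ∫⁻ x in Set.Ioi 0, ENNReal.ofReal (Real.exp (-x)) * φ x := by
  have h : expMeasure 1 = volume.withDensity (exponentialPDF 1) := rfl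
  have hm : Measurable (exponentialPDF 1) := (measurable_exponentialPDFReal 1).ennreal_ofReal
  rw [h, lintegral_withDensity_eq_lintegral_mul _ hm hφ, ← setLIntegral_eq_of_support_subset
    (s := Set.Ici 0), setLIntegral_congr Ioi_ae_eq_Ici.symm]
  · refine setLIntegral_congr_fun measurableSet_Ioi fun x hx => ?_
    simp [exponentialPDF_of_nonneg (le_of_lt hx)]
  · intro x hx
    by_contra h0
    refine hx ?_
    simp [exponentialPDF_of_neg (not_le.1 h0)]

theorem ae_expMeasure_one_pos : ∀ᵐ x ∂expMeasure 1, 0 < x := by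
  have h : ∫⁻ x, (Set.Iic (0 : ℝ)).indicator 1 x ∂expMeasure 1 = 0 := by
    rw [lintegral_expMeasure_one (measurable_one.indicator measurableSet_Iic)]
    refine (setLIntegral_congr_fun (g := fun _ => 0) measurableSet_Ioi fun x hx => ?_).trans
      lintegral_zero
    simp [show ¬ x ≤ 0 from not_le.2 hx]
  rw [lintegral_indicator_one measurableSet_Iic] at h
  rw [ae_iff]
  simpa [Set.Iic] using h

section RightContinuous

variable {H : ℝ → ℝ} {C : ℝ} (hH0 : ∀ s, 0 ≤ H s) (hHC : ∀ s, H s ≤ C) (hHm : Measurable H)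
  (hHr : ∀ s, 0 ≤ s → ContinuousWithinAt H (Set.Ioi s) s)

theorem intervalIntegrable_of_nonneg_of_le (hH0 : ∀ s, 0 ≤ H s) (hHC : ∀ s, H s ≤ C)
    (hHm : Measurable H) (a b : ℝ) : IntervalIntegrable H volume a b := by
  refine (intervalIntegrable_const (c := C)).mono_fun' hHm.aestronglyMeasurable
    (ae_of_all _ fun s => ?_)
  exact (Real.norm_of_nonneg (hH0 s)).trans_le (hHC s)

include hH0 hHC hHm in
theorem continuous_primitive_of_bounded : Continuous fun t => ∫ s in (0 : ℝ)..t, H s :=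
  intervalIntegral.continuous_primitive (intervalIntegrable_of_nonneg_of_le hH0 hHC hHm) 0

include hH0 hHC hHm hHr in
/-- A right continuous function is the right derivative of its primitive, which suffices for the
fundamental theorem of calculus. -/
theorem integral_primitive_pow_mul {τ : ℝ} (hτ : 0 ≤ τ) (k : ℕ) :
    ∫ y in (0 : ℝ)..τ, (∫ s in (0 : ℝ)..y, H s) ^ k * H y =
      (∫ s in (0 : ℝ)..τ, H s) ^ (k + 1) / (k + 1) := by
  set G : ℝ → ℝ := fun t => ∫ s in (0 : ℝ)..t, H s with hG
  have hGc : Continuous G := continuous_primitive_of_bounded hH0 hHC hHm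
  have hII := intervalIntegrable_of_nonneg_of_le hH0 hHC hHm
  have hd : ∀ x ∈ Set.Ioo 0 τ, HasDerivWithinAt (fun y => G y ^ (k + 1) / (k + 1))
      (G x ^ k * H x) (Set.Ioi x) x := by
    intro x hx
    have h1 : HasDerivWithinAt G (H x) (Set.Ici x) x :=
      intervalIntegral.integral_hasDerivWithinAt_right (hII 0 x)
        hHm.stronglyMeasurable.stronglyMeasurableAtFilter (hHr x hx.1.le)
    convert! ((h1.mono Set.Ioi_subset_Ici_self).pow (k + 1)).div_const ((k : ℝ) + 1) using 1
    push_cast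
    field_simp
  have hcont : Continuous fun y => G y ^ k := hGc.pow k
  rw [intervalIntegral.integral_eq_sub_of_hasDeriv_right_of_le hτ
    (by fun_prop) hd ((hII 0 τ).continuousOn_mul hcont.continuousOn)]
  simp [hG]

include hH0 hHC hHm hHr in
/-- The expectation of `∏_{r < n} H (τ - T_r)` on the event that at most `n - 1` of the points
`T_0 < T_1 < …` of a Poisson process of rate one are in `[0, τ]`.  By the independence of the first
point and the later interarrival times, the expectation satisfies a recursion in `n`. -/
theorem lintegral_poisson_prod (hHneg : ∀ s, s < 0 → H s = 1) (n : ℕ) (τ : ℝ) :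
    ∫⁻ e : ℕ → ℝ, (Set.Ioi τ).indicator 1 (∑ k ∈ Finset.range n, e k) *
        ∏ r ∈ Finset.range n, ENNReal.ofReal (H (τ - ∑ k ∈ Finset.range (r + 1), e k))
        ∂Measure.infinitePi (fun _ : ℕ => expMeasure 1) =
      if τ < 0 then 1 else ENNReal.ofReal (Real.exp (-τ) *
        ∑ k ∈ Finset.range n, (∫ s in (0 : ℝ)..τ, H s) ^ k / k.factorial) := by
  set G : ℝ → ℝ := fun t => ∫ s in (0 : ℝ)..t, H s with hG
  have hGc : Continuous G := continuous_primitive_of_bounded hH0 hHC hHm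
  have hII := intervalIntegrable_of_nonneg_of_le hH0 hHC hHm
  have hG0 : ∀ t, 0 ≤ t → 0 ≤ G t := fun t ht =>
    intervalIntegral.integral_nonneg ht fun s _ => hH0 s
  induction n generalizing τ with
  | zero =>
    by_cases hτ : τ < 0
    · simp [hτ]
    · simp [hτ]
  | succ n ih =>
    have hmeas : ∀ n : ℕ, Measurable fun e : ℕ → ℝ =>
        ((Set.Ioi τ).indicator 1 (∑ k ∈ Finset.range n, e k) : ℝ≥0∞) *
        ∏ r ∈ Finset.range n, ENNReal.ofReal (H (τ - ∑ k ∈ Finset.range (r + 1), e k)) := by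
      intro n
      refine Measurable.mul ((measurable_one.indicator measurableSet_Ioi).comp (by fun_prop)) ?_
      exact Finset.measurable_fun_prod _ fun r _ => (hHm.comp (by fun_prop)).ennreal_ofReal
    have hmeas' : ∀ x : ℝ, Measurable fun e : ℕ → ℝ =>
        ((Set.Ioi (τ - x)).indicator 1 (∑ k ∈ Finset.range n, e k) : ℝ≥0∞) *
        ∏ r ∈ Finset.range n, ENNReal.ofReal (H (τ - x - ∑ k ∈ Finset.range (r + 1), e k)) := by
      intro x
      refine Measurable.mul ((measurable_one.indicator measurableSet_Ioi).comp (by fun_prop)) ?_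
      exact Finset.measurable_fun_prod _ fun r _ => (hHm.comp (by fun_prop)).ennreal_ofReal
    have hrec : ∀ (x : ℝ) (e : ℕ → ℝ),
        ((Set.Ioi τ).indicator 1
          (∑ k ∈ Finset.range (n + 1), (Nat.casesOn k x e : ℝ)) : ℝ≥0∞) *
        ∏ r ∈ Finset.range (n + 1),
          ENNReal.ofReal (H (τ - ∑ k ∈ Finset.range (r + 1), (Nat.casesOn k x e : ℝ))) =
        ENNReal.ofReal (H (τ - x)) *
        (((Set.Ioi (τ - x)).indicator 1 (∑ k ∈ Finset.range n, e k) : ℝ≥0∞) *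
        ∏ r ∈ Finset.range n, ENNReal.ofReal (H (τ - x - ∑ k ∈ Finset.range (r + 1), e k))) := by
      intro x e
      have hsum : ∀ N : ℕ, ∑ k ∈ Finset.range (N + 1), (Nat.casesOn k x e : ℝ) =
          ∑ k ∈ Finset.range N, e k + x := fun N => Finset.sum_range_succ' _ _
      have h1 : ∀ y : ℝ, ((Set.Ioi τ).indicator 1 (y + x) : ℝ≥0∞) =
          (Set.Ioi (τ - x)).indicator 1 y := by
        intro y
        simp only [Set.indicator, Set.mem_Ioi, sub_lt_iff_lt_add]
        rfl
      simp only [hsum]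
      rw [Finset.prod_range_succ', h1, mul_comm (ENNReal.ofReal (H (τ - x))), mul_assoc]
      simp only [Finset.range_zero, Finset.sum_empty, zero_add, sub_sub, add_comm x]
    rw [lintegral_infinitePi_nat _ (hmeas (n + 1))]
    simp only [hrec]
    have hin : ∀ x, ∫⁻ e : ℕ → ℝ, ENNReal.ofReal (H (τ - x)) *
        (((Set.Ioi (τ - x)).indicator 1 (∑ k ∈ Finset.range n, e k) : ℝ≥0∞) *
        ∏ r ∈ Finset.range n, ENNReal.ofReal (H (τ - x - ∑ k ∈ Finset.range (r + 1), e k)))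
        ∂Measure.infinitePi (fun _ : ℕ => expMeasure 1) =
        ENNReal.ofReal (H (τ - x)) * if τ - x < 0 then 1 else
          ENNReal.ofReal (Real.exp (-(τ - x)) *
            ∑ k ∈ Finset.range n, G (τ - x) ^ k / k.factorial) := by
      intro x
      rw [lintegral_const_mul _ (hmeas' x), ih]
    simp only [hin]
    by_cases hτ : τ < 0
    · rw [if_pos hτ]
      calc _ = ∫⁻ _x, 1 ∂expMeasure 1 := by
            refine lintegral_congr_ae ?_
            filter_upwards [ae_expMeasure_one_pos] with x hx
            rw [if_pos (by linarith), hHneg _ (by linarith)]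
            simp
        _ = 1 := by simp
    rw [if_neg hτ]
    have hτ0 : 0 ≤ τ := not_lt.1 hτ
    rw [lintegral_expMeasure_one]
    swap
    · refine Measurable.mul (hHm.comp (by fun_prop)).ennreal_ofReal
        (Measurable.ite (measurableSet_lt (by fun_prop) measurable_const) measurable_const ?_)
      fun_prop
    rw [← Set.Ioc_union_Ioi_eq_Ioi hτ0, lintegral_union measurableSet_Ioi
      (Set.Ioc_disjoint_Ioi le_rfl)]
    set P : ℝ → ℝ := fun y => ∑ k ∈ Finset.range n, G y ^ k / k.factorial with hP
    have hPc : Continuous P := by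
      simp only [hP]
      fun_prop
    have hP0 : ∀ y, 0 ≤ y → 0 ≤ P y := fun y hy =>
      Finset.sum_nonneg fun k _ => div_nonneg (pow_nonneg (hG0 y hy) k) (by positivity)
    -- If the first point `x` is beyond `τ`, there are no factors at all.
    have hA : ∫⁻ x in Set.Ioi τ, ENNReal.ofReal (Real.exp (-x)) *
        (ENNReal.ofReal (H (τ - x)) * if τ - x < 0 then 1 else
          ENNReal.ofReal (Real.exp (-(τ - x)) * P (τ - x))) = ENNReal.ofReal (Real.exp (-τ)) := by
      rw [← integral_exp_neg_Ioi τ, ofReal_integral_eq_lintegral_ofReal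
        (integrableOn_exp_neg_Ioi τ) (ae_of_all _ fun _ => (Real.exp_pos _).le)]
      refine setLIntegral_congr_fun measurableSet_Ioi fun x hx => ?_
      have hx' : τ - x < 0 := sub_neg.2 hx
      simp [hx', hHneg _ hx']
    have hint : IntervalIntegrable (fun y => P y * H y) volume 0 τ :=
      (hII 0 τ).continuousOn_mul hPc.continuousOn
    -- Otherwise the process starts afresh at `x`, with the remaining time `τ - x`.
    have hB : ∫⁻ x in Set.Ioc 0 τ, ENNReal.ofReal (Real.exp (-x)) *
        (ENNReal.ofReal (H (τ - x)) * if τ - x < 0 then 1 else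
          ENNReal.ofReal (Real.exp (-(τ - x)) * P (τ - x))) =
        ENNReal.ofReal (Real.exp (-τ) * ∫ y in (0 : ℝ)..τ, P y * H y) := by
      have h1 : ∫ y in (0 : ℝ)..τ, P y * H y = ∫ x in (0 : ℝ)..τ, P (τ - x) * H (τ - x) := by
        rw [intervalIntegral.integral_comp_sub_left (fun y => P y * H y) τ]
        simp
      have hint' : IntervalIntegrable (fun x => P (τ - x) * H (τ - x)) volume 0 τ := by
        have := hint.comp_sub_left τ
        simpa using this.symm
      rw [h1, ← intervalIntegral.integral_const_mul, intervalIntegral.integral_of_le hτ0,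
        ofReal_integral_eq_lintegral_ofReal]
      · refine setLIntegral_congr_fun measurableSet_Ioc fun x hx => ?_
        have hx' : ¬ τ - x < 0 := by simpa using hx.2
        simp only [if_neg hx']
        rw [← ENNReal.ofReal_mul (hH0 _), ← ENNReal.ofReal_mul (Real.exp_pos _).le]
        congr 1
        have : Real.exp (-τ) = Real.exp (-x) * Real.exp (-(τ - x)) := by
          rw [← Real.exp_add]; congr 1; ring
        rw [this]
        ring
      · exact ((intervalIntegrable_iff_integrableOn_Ioc_of_le hτ0).1 hint').const_mul _
      · refine (ae_restrict_iff' measurableSet_Ioc).2 (ae_of_all _ fun x hx => ?_)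
        exact mul_nonneg (Real.exp_pos _).le
          (mul_nonneg (hP0 _ (by linarith [hx.2])) (hH0 _))
    have hPint : ∫ y in (0 : ℝ)..τ, P y * H y =
        ∑ k ∈ Finset.range n, G τ ^ (k + 1) / (k + 1).factorial := by
      simp only [hP, Finset.sum_mul]
      rw [intervalIntegral.integral_finsetSum]
      · refine Finset.sum_congr rfl fun k _ => ?_
        have h2 : ∀ y, G y ^ k / k.factorial * H y = (k.factorial : ℝ)⁻¹ * (G y ^ k * H y) :=
          fun y => by ring
        simp only [h2]
        rw [intervalIntegral.integral_const_mul,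
          integral_primitive_pow_mul hH0 hHC hHm hHr hτ0 k, Nat.factorial_succ]
        push_cast
        have : (k.factorial : ℝ) ≠ 0 := by positivity
        field_simp
        rfl
      · intro k _
        exact (hII 0 τ).continuousOn_mul
          ((by fun_prop : Continuous fun y => G y ^ k / (k.factorial : ℝ)).continuousOn)
    rw [hA, hB, hPint, ← ENNReal.ofReal_add _ (Real.exp_pos _).le, Finset.sum_range_succ']
    · congr 1
      simp
      ring
    · exact mul_nonneg (Real.exp_pos _).le (Finset.sum_nonneg fun k _ =>
        div_nonneg (pow_nonneg (hG0 τ hτ0) _) (by positivity))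

include hH0 hHC hHm hHr in
theorem tendsto_lintegral_poisson_prod (hHneg : ∀ s, s < 0 → H s = 1) {τ : ℝ} (hτ : 0 ≤ τ) :
    Tendsto (fun n : ℕ => ∫⁻ e : ℕ → ℝ, (Set.Ioi τ).indicator 1 (∑ k ∈ Finset.range n, e k) *
        ∏ r ∈ Finset.range n, ENNReal.ofReal (H (τ - ∑ k ∈ Finset.range (r + 1), e k))
        ∂Measure.infinitePi (fun _ : ℕ => expMeasure 1)) atTop
      (𝓝 (ENNReal.ofReal (Real.exp ((∫ s in (0 : ℝ)..τ, H s) - τ)))) := by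
  simp only [lintegral_poisson_prod hH0 hHC hHm hHr hHneg, if_neg (not_lt.2 hτ)]
  refine ENNReal.tendsto_ofReal ?_
  rw [sub_eq_neg_add, Real.exp_add]
  refine Tendsto.const_mul _ ?_
  have := NormedSpace.expSeries_div_hasSum_exp (𝔸 := ℝ) (∫ s in (0 : ℝ)..τ, H s)
  rw [← Real.exp_eq_exp_ℝ] at this
  exact this.tendsto_sum_nat

end RightContinuous

/-- The Poisson process has finitely many points in bounded intervals. -/
theorem ae_exists_lt_sum_range (τ : ℝ) :
    ∀ᵐ e ∂Measure.infinitePi (fun _ : ℕ => expMeasure 1), ∃ n, τ < ∑ k ∈ Finset.range n, e k := by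
  by_cases hτ : τ < 0
  · exact ae_of_all _ fun e => ⟨0, by simpa using hτ⟩
  have h := tendsto_lintegral_poisson_prod (H := fun _ => 1) (C := 1) (fun _ => zero_le_one)
    (fun _ => le_rfl) measurable_const (fun _ _ => continuousWithinAt_const) (fun _ _ => rfl)
    (not_lt.1 hτ)
  simp only [ENNReal.ofReal_one, Finset.prod_const_one, mul_one, intervalIntegral.integral_const,
    sub_zero, smul_eq_mul, mul_one, sub_self, Real.exp_zero] at h
  set μ := Measure.infinitePi (fun _ : ℕ => expMeasure 1)
  set A : ℕ → Set (ℕ → ℝ) := fun n => {e | τ < ∑ k ∈ Finset.range n, e k} with hA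
  have hAm : ∀ n, MeasurableSet (A n) := fun n =>
    measurableSet_lt measurable_const (by fun_prop)
  have h' : Tendsto (fun n => μ (A n)) atTop (𝓝 1) := by
    refine h.congr fun n => ?_
    rw [← lintegral_indicator_one (hAm n)]
    rfl
  have hle : 1 ≤ μ (⋃ n, A n) := le_of_tendsto' h' fun n => measure_mono (Set.subset_iUnion A n)
  have hc := (prob_compl_eq_zero_iff (MeasurableSet.iUnion hAm)).2 (le_antisymm prob_le_one hle)
  filter_upwards [measure_eq_zero_iff_ae_notMem.1 hc] with e he
  simpa [hA] using he

/-! ### The growth of one cluster in time -/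

/-- The delays between the births of the potential members `p` of one cluster and the births of
their potential children `q`. -/
abbrev Delays (d : ℕ) : Type := List (Fin d × ℕ) × (Fin d × ℕ) → ℝ

/-- The time between the arrival of the immigrant and the birth of the member `p`. -/
def TreeAge (D : Delays d) : List (Fin d × ℕ) → ℝ
  | [] => 0
  | q :: p => TreeAge D p + D (p, q)

theorem treeAge_nonneg {D : Delays d} (hD : ∀ q, 0 < D q) (p : List (Fin d × ℕ)) :
    0 ≤ TreeAge D p := by
  induction p with
  | nil => exact le_rfl
  | cons q p ih => exact add_nonneg ih (hD _).le

theorem measurable_treeAge {Ω : Type*} [MeasurableSpace Ω] {D : Ω → Delays d}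
    (hD : Measurable D) (p : List (Fin d × ℕ)) : Measurable fun ω => TreeAge (D ω) p := by
  induction p with
  | nil => exact measurable_const
  | cons q p ih => exact ih.add ((measurable_pi_apply (p, q)).comp hD)

/-- The product of the weights `z` of the members of a cluster that are born up to the age `u` of
the cluster. -/
noncomputable def treeWeight (z : Fin d → ℝ≥0∞) (j : Fin d) (u : ℝ) (K : Litters d)
    (D : Delays d) : ℝ≥0∞ :=
  ∏ l, z l ^ Set.ncard {p | (TreeBorn K p ∧ TreeAge D p ≤ u) ∧ kind j p = l}

theorem measurable_treeWeight {Ω : Type*} [MeasurableSpace Ω] (z : Fin d → ℝ≥0∞) (j : Fin d)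
    {u : Ω → ℝ} {K : Ω → Litters d} {D : Ω → Delays d} (hu : Measurable u) (hK : Measurable K)
    (hD : Measurable D) : Measurable fun ω => treeWeight z j (u ω) (K ω) (D ω) := by
  refine measurable_prod_pow_ncard z
    (fun l ω p => (TreeBorn (K ω) p ∧ TreeAge (D ω) p ≤ u ω) ∧ kind j p = l) fun l p => ?_
  exact ((measurableSet_treeBorn hK p).inter
    (measurableSet_le (measurable_treeAge hD p) hu)).inter (MeasurableSet.const _)

theorem treeWeight_eq_prod (z : Fin d → ℝ≥0∞) (j : Fin d) (u : ℝ) {K : Litters d}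
    (D : Delays d) {s : Finset (List (Fin d × ℕ))} (hs : ∀ p, TreeBorn K p ↔ p ∈ s) :
    treeWeight z j u K D = ∏ p ∈ s.filter fun p => TreeAge D p ≤ u, z (kind j p) :=
  prod_pow_ncard_eq z (kind j) fun p => by rw [Finset.mem_filter, hs]

theorem treeWeight_of_neg (z : Fin d → ℝ≥0∞) (j : Fin d) {u : ℝ} (hu : u < 0) (K : Litters d)
    {D : Delays d} (hD : ∀ q, 0 < D q) : treeWeight z j u K D = 1 := by
  refine Finset.prod_eq_one fun l _ => ?_
  have : {p | (TreeBorn K p ∧ TreeAge D p ≤ u) ∧ kind j p = l} = ∅ := by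
    ext p
    simp only [Set.mem_ofPred_eq, Set.mem_empty_iff_false, iff_false, not_and]
    exact fun h => absurd (treeAge_nonneg hD p) (not_le.2 (h.2.trans_lt hu))
  rw [this, Set.ncard_empty, pow_zero]

theorem treeWeight_le {z w : Fin d → ℝ≥0∞} (hzw : ∀ l, z l ≤ w l) (hw : ∀ l, 1 ≤ w l)
    (j : Fin d) (u : ℝ) {K : Litters d} (hK : ∃ n, gen K n = ∅) (D : Delays d) :
    treeWeight z j u K D ≤ ∏ l, w l ^ Set.ncard {p | TreeBorn K p ∧ kind j p = l} := by
  obtain ⟨s, hs, -⟩ := exists_finset_treeBorn hK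
  rw [treeWeight_eq_prod z j u D hs, prod_pow_ncard_eq w (kind j) hs]
  calc _ ≤ ∏ p ∈ s.filter fun p => TreeAge D p ≤ u, w (kind j p) :=
        Finset.prod_le_prod' fun p _ => hzw _
    _ ≤ _ := Finset.prod_le_prod_of_subset_of_one_le' (Finset.filter_subset _ _)
        fun p _ _ => hw _

theorem tendsto_treeWeight_atTop (z : Fin d → ℝ≥0∞) (j : Fin d) {K : Litters d}
    (hK : ∃ n, gen K n = ∅) (D : Delays d) :
    Tendsto (fun u => treeWeight z j u K D) atTop
      (𝓝 (∏ l, z l ^ Set.ncard {p | TreeBorn K p ∧ kind j p = l})) := by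
  obtain ⟨s, hs, -⟩ := exists_finset_treeBorn hK
  refine tendsto_const_nhds.congr' ?_
  filter_upwards [(Finset.eventually_all s).2 fun p _ => eventually_ge_atTop (TreeAge D p)]
    with u hu
  rw [treeWeight_eq_prod z j u D hs, prod_pow_ncard_eq z (kind j) hs, Finset.filter_true_of_mem hu]

theorem continuousWithinAt_treeWeight (z : Fin d → ℝ≥0∞) (j : Fin d) {K : Litters d}
    (hK : ∃ n, gen K n = ∅) (D : Delays d) (u : ℝ) :
    ContinuousWithinAt (fun u => treeWeight z j u K D) (Set.Ioi u) u := by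
  obtain ⟨s, hs, -⟩ := exists_finset_treeBorn hK
  refine tendsto_const_nhds.congr' ?_
  have : ∀ᶠ v in 𝓝[>] u, ∀ p ∈ s, (TreeAge D p ≤ u ↔ TreeAge D p ≤ v) := by
    refine (Finset.eventually_all s).2 fun p _ => ?_
    by_cases h : TreeAge D p ≤ u
    · filter_upwards [self_mem_nhdsWithin] with v hv
      exact ⟨fun h' => h'.trans (le_of_lt hv), fun _ => h⟩
    · filter_upwards [nhdsWithin_le_nhds (gt_mem_nhds (not_le.1 h))] with v hv
      exact ⟨fun h' => absurd h' h, fun h' => absurd h' (not_le.2 hv)⟩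
  filter_upwards [this] with v hv
  rw [treeWeight_eq_prod z j u D hs, treeWeight_eq_prod z j v D hs, Finset.filter_congr hv]

/-- The law of the delays in a cluster with root in component `j`. -/
noncomputable def treeDelayLaw (j : Fin d) : Measure (Delays d) :=
  Measure.infinitePi fun q => M.delayLaw q.2.1 (kind j q.1)

instance (j : Fin d) : IsProbabilityMeasure (M.treeDelayLaw j) := by
  unfold treeDelayLaw
  infer_instance

theorem ae_delayLaw_pos (m j : Fin d) : ∀ᵐ v ∂M.delayLaw m j, 0 < v := by
  unfold delayLaw
  split_ifs with h
  · simp [ae_dirac_eq]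
  · refine Measure.ae_smul_measure ?_ _
    exact (withDensity_absolutelyContinuous _ _).ae_le (ae_restrict_mem measurableSet_Ioi)

theorem ae_infinitePi_forall {ι : Type*} [Countable ι] {X : ι → Type*} [∀ i, MeasurableSpace (X i)]
    (μ : ∀ i, Measure (X i)) [∀ i, IsProbabilityMeasure (μ i)] {P : ∀ i, X i → Prop}
    (h : ∀ i, ∀ᵐ x ∂μ i, P i x) : ∀ᵐ ω ∂Measure.infinitePi μ, ∀ i, P i (ω i) :=
  ae_all_iff.2 fun i => (measurePreserving_eval_infinitePi μ i).quasiMeasurePreserving.ae (h i)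

/-- `E[∏_l z_l ^ S_{l←j}(u)]`, where `S_{l←j}(u)` is the number of events in component `l` in a
cluster with root in component `j` up to the age `u` of the cluster. -/
noncomputable def clusterPgf (z : Fin d → ℝ≥0∞) (j : Fin d) (u : ℝ) : ℝ≥0∞ :=
  ∫⁻ K, ∫⁻ D, treeWeight z j u K D ∂M.treeDelayLaw j ∂litterLaw M.litter j

/-- `E[∏_l z_l ^ S_{l←j}]` for the total numbers `S_{l←j}` of events in a cluster. -/
noncomputable def totalPgf (z : Fin d → ℝ≥0∞) (j : Fin d) : ℝ≥0∞ :=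
  ∫⁻ K, ∏ l, z l ^ Set.ncard {p | TreeBorn K p ∧ kind j p = l} ∂litterLaw M.litter j

theorem measurable_clusterPgf (z : Fin d → ℝ≥0∞) (j : Fin d) :
    Measurable (M.clusterPgf z j) := by
  unfold clusterPgf
  refine Measurable.lintegral_prod_right' (f := fun x : ℝ × Litters d =>
    ∫⁻ D, treeWeight z j x.1 x.2 D ∂M.treeDelayLaw j) ?_
  refine Measurable.lintegral_prod_right' (f := fun x : (ℝ × Litters d) × Delays d =>
    treeWeight z j x.1.1 x.1.2 x.2) ?_
  exact measurable_treeWeight z j (by fun_prop) (by fun_prop) (by fun_prop)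

theorem clusterPgf_of_neg (z : Fin d → ℝ≥0∞) (j : Fin d) {u : ℝ} (hu : u < 0) :
    M.clusterPgf z j u = 1 := by
  have h : ∀ K, ∫⁻ D, treeWeight z j u K D ∂M.treeDelayLaw j = 1 := by
    intro K
    calc _ = ∫⁻ _D, 1 ∂M.treeDelayLaw j := by
          refine lintegral_congr_ae ?_
          filter_upwards [ae_infinitePi_forall (fun q : List (Fin d × ℕ) × (Fin d × ℕ) =>
            M.delayLaw q.2.1 (kind j q.1)) fun q => M.ae_delayLaw_pos _ _] with D hD
          exact treeWeight_of_neg z j hu K hD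
      _ = 1 := by simp
  simp [clusterPgf, h]

section

variable {z w : Fin d → ℝ≥0∞} {j : Fin d}

theorem clusterPgf_le (hfin : ∀ᵐ K ∂litterLaw M.litter j, ∃ n, gen K n = ∅)
    (hzw : ∀ l, z l ≤ w l) (hw : ∀ l, 1 ≤ w l) (u : ℝ) :
    M.clusterPgf z j u ≤ M.totalPgf w j := by
  refine lintegral_mono_ae ?_
  filter_upwards [hfin] with K hK
  calc _ ≤ ∫⁻ _D, ∏ l, w l ^ Set.ncard {p | TreeBorn K p ∧ kind j p = l} ∂M.treeDelayLaw j :=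
        lintegral_mono fun D => treeWeight_le hzw hw j u hK D
    _ = _ := by simp

/-- Dominated convergence for `clusterPgf`; a dominating function is available because the weights
`w ≥ 1` have a finite total generating function. -/
theorem tendsto_clusterPgf (hfin : ∀ᵐ K ∂litterLaw M.litter j, ∃ n, gen K n = ∅)
    (hzw : ∀ l, z l ≤ w l) (hw : ∀ l, 1 ≤ w l) (hwfin : M.totalPgf w j ≠ ∞)
    {F : Filter ℝ} [F.IsCountablyGenerated] {g : Litters d → Delays d → ℝ≥0∞}
    (hg : ∀ K D, (∃ n, gen K n = ∅) → Tendsto (fun u => treeWeight z j u K D) F (𝓝 (g K D))) :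
    Tendsto (M.clusterPgf z j) F
      (𝓝 (∫⁻ K, ∫⁻ D, g K D ∂M.treeDelayLaw j ∂litterLaw M.litter j)) := by
  have hmK : Measurable fun K : Litters d =>
      ∏ l, w l ^ Set.ncard {p | TreeBorn K p ∧ kind j p = l} :=
    measurable_prod_pow_ncard w (fun l K p => TreeBorn K p ∧ kind j p = l) fun l p =>
      (measurableSet_treeBorn measurable_id p).inter (MeasurableSet.const _)
  have hlt : ∀ᵐ K ∂litterLaw M.litter j,
      ∏ l, w l ^ Set.ncard {p | TreeBorn K p ∧ kind j p = l} < ∞ := ae_lt_top hmK hwfin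
  refine tendsto_lintegral_filter_of_dominated_convergence
    (fun K => ∏ l, w l ^ Set.ncard {p | TreeBorn K p ∧ kind j p = l}) ?_ ?_ hwfin ?_
  · refine Eventually.of_forall fun u => ?_
    exact Measurable.lintegral_prod_right' (f := fun x : Litters d × Delays d =>
      treeWeight z j u x.1 x.2) (measurable_treeWeight z j measurable_const measurable_fst
        measurable_snd)
  · refine Eventually.of_forall fun u => ?_
    filter_upwards [hfin] with K hK
    calc _ ≤ ∫⁻ _D, ∏ l, w l ^ Set.ncard {p | TreeBorn K p ∧ kind j p = l} ∂M.treeDelayLaw j :=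
          lintegral_mono fun D => treeWeight_le hzw hw j u hK D
      _ = _ := by simp
  · filter_upwards [hfin, hlt] with K hK hKlt
    refine tendsto_lintegral_filter_of_dominated_convergence
      (fun _ => ∏ l, w l ^ Set.ncard {p | TreeBorn K p ∧ kind j p = l}) ?_ ?_
      (by simpa using hKlt.ne)
      (ae_of_all _ fun D => hg K D hK)
    · exact Eventually.of_forall fun u =>
        measurable_treeWeight z j measurable_const measurable_const measurable_id
    · exact Eventually.of_forall fun u => ae_of_all _ fun D => treeWeight_le hzw hw j u hK D

theorem tendsto_clusterPgf_atTop (hfin : ∀ᵐ K ∂litterLaw M.litter j, ∃ n, gen K n = ∅)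
    (hzw : ∀ l, z l ≤ w l) (hw : ∀ l, 1 ≤ w l) (hwfin : M.totalPgf w j ≠ ∞) :
    Tendsto (M.clusterPgf z j) atTop (𝓝 (M.totalPgf z j)) := by
  have := M.tendsto_clusterPgf (F := atTop) hfin hzw hw hwfin
    fun K D hK => tendsto_treeWeight_atTop z j hK D
  simpa [totalPgf] using this

theorem continuousWithinAt_clusterPgf (hfin : ∀ᵐ K ∂litterLaw M.litter j, ∃ n, gen K n = ∅)
    (hzw : ∀ l, z l ≤ w l) (hw : ∀ l, 1 ≤ w l) (hwfin : M.totalPgf w j ≠ ∞) (u : ℝ) :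
    ContinuousWithinAt (M.clusterPgf z j) (Set.Ioi u) u :=
  M.tendsto_clusterPgf hfin hzw hw hwfin fun _ D hK => continuousWithinAt_treeWeight z j hK D u

end

/-! ### The clusters inside the sample space -/

theorem comp_eq_kind (a : Fin d × ℕ) (p : List (Fin d × ℕ)) : comp (a, p) = kind a.1 p := by
  cases p <;> rfl

theorem born_iff (ω : Sample d dstar) (a : Fin d × ℕ) (p : List (Fin d × ℕ)) :
    Born ω a p ↔ TreeBorn (fun p => ω.2.1 (a, p)) p := by
  induction p with
  | nil => exact Iff.rfl
  | cons q p ih => exact and_congr ih Iff.rfl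

theorem age_eq (ω : Sample d dstar) (a : Fin d × ℕ) (p : List (Fin d × ℕ)) :
    age ω a p = TreeAge (fun q => ω.2.2.1 ((a, q.1), q.2)) p := by
  induction p with
  | nil => rfl
  | cons q p ih => exact congrArg (· + _) ih

theorem map_litterLaw (a : Fin d × ℕ) :
    (Measure.infinitePi fun ℓ : Label d =>
      (M.markLaw (comp ℓ)) ⊗ₘ (M.offspringKernel (comp ℓ))).map (fun κ p => κ (a, p)) =
      litterLaw M.litter a.1 := by
  rw [Measure.map_infinitePi_infinitePi_of_inj (f := fun p => (a, p))
    fun p p' h => (Prod.mk.inj h).2, litterLaw]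
  congr 1
  funext p
  rw [comp_eq_kind]
  rfl

theorem f_eq_totalPgf (j : Fin d) (z : Fin d → ℝ≥0∞) : M.f j z = M.totalPgf z j := by
  have hm : Measurable fun K : Litters d =>
      ∏ l, z l ^ Set.ncard {p | TreeBorn K p ∧ kind j p = l} :=
    measurable_prod_pow_ncard z (fun l K p => TreeBorn K p ∧ kind j p = l) fun l p =>
      (measurableSet_treeBorn measurable_id p).inter (MeasurableSet.const _)
  have hb : Measurable fun (κ : Label d → (Fin d → ℝ) × (Fin d → ℕ)) p => κ ((j, 0), p) := by
    fun_prop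
  rw [totalPgf, ← M.map_litterLaw (j, 0), lintegral_map hm hb]
  have hf : M.f j z = ∫⁻ ω, ∏ l, z l ^ Set.ncard {p | TreeBorn (fun p => ω.2.1 ((j, 0), p)) p ∧
      kind j p = l} ∂M.prob := by
    simp only [f, clusterSize, born_iff]
    rfl
  rw [hf, prob]
  have h1 := (measurePreserving_snd (μ := Measure.infinitePi fun _ : Fin d × ℕ => expMeasure 1)
    (ν := (Measure.infinitePi fun ℓ : Label d =>
      (M.markLaw (comp ℓ)) ⊗ₘ (M.offspringKernel (comp ℓ))).prod <|
      (Measure.infinitePi fun q : Label d × Fin d × ℕ => M.delayLaw q.2.1 (comp q.1)).prod <|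
      Measure.infinitePi fun q : Fin d × ℕ => M.claimLaw q.1))
  have h2 := (measurePreserving_fst (μ := Measure.infinitePi fun ℓ : Label d =>
      (M.markLaw (comp ℓ)) ⊗ₘ (M.offspringKernel (comp ℓ)))
    (ν := (Measure.infinitePi fun q : Label d × Fin d × ℕ => M.delayLaw q.2.1 (comp q.1)).prod <|
      Measure.infinitePi fun q : Fin d × ℕ => M.claimLaw q.1))
  exact (h2.comp h1).lintegral_comp (hm.comp hb)

/-! ### Integrating out the claims -/

/-- The product `∏_l z_l ^ N_l(t)`, as a function of the interarrival times, the litters and the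
delays. -/
noncomputable def eventWeight (z : Fin d → ℝ≥0∞) (t : ℝ) (e : Fin d × ℕ → ℝ)
    (κ : Label d → (Fin d → ℝ) × (Fin d → ℕ)) (δ : Label d × Fin d × ℕ → ℝ) : ℝ≥0∞ :=
  ∏ l, z l ^ M.N t l (e, κ, δ, 0)

theorem N_eq (t : ℝ) (i : Fin d) (ω : Sample d dstar) :
    M.N t i ω = Set.ncard {ℓ : Label d | (0 < M.rate ℓ.1.1 ∧
      TreeBorn (fun p => ω.2.1 (ℓ.1, p)) ℓ.2 ∧
      TreeAge (fun q => ω.2.2.1 ((ℓ.1, q.1), q.2)) ℓ.2 ≤ t - M.arrival ω ℓ.1) ∧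
      comp ℓ = i} := by
  unfold N
  congr 1
  ext ℓ
  simp only [Set.mem_ofPred_eq, born_iff, age_eq, le_sub_iff_add_le']
  tauto

theorem measurable_arrival (a : Fin d × ℕ) :
    Measurable fun ω : Sample d dstar => M.arrival ω a := by
  unfold arrival
  fun_prop

theorem measurableSet_N (t : ℝ) (i : Fin d) (ℓ : Label d) :
    MeasurableSet {ω : Sample d dstar | (0 < M.rate ℓ.1.1 ∧
      TreeBorn (fun p => ω.2.1 (ℓ.1, p)) ℓ.2 ∧
      TreeAge (fun q => ω.2.2.1 ((ℓ.1, q.1), q.2)) ℓ.2 ≤ t - M.arrival ω ℓ.1) ∧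
      comp ℓ = i} := by
  refine MeasurableSet.inter (MeasurableSet.inter (MeasurableSet.const _)
    (MeasurableSet.inter ?_ ?_)) (MeasurableSet.const _)
  · exact measurableSet_treeBorn (K := fun ω : Sample d dstar => fun p => ω.2.1 (ℓ.1, p))
      (by fun_prop) ℓ.2
  · exact measurableSet_le (measurable_treeAge
      (D := fun ω : Sample d dstar => fun q => ω.2.2.1 ((ℓ.1, q.1), q.2)) (by fun_prop) ℓ.2)
      (measurable_const.sub (M.measurable_arrival ℓ.1))

theorem measurable_N (t : ℝ) (i : Fin d) : Measurable (M.N t i) := by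
  rw [funext (M.N_eq t i)]
  exact measurable_ncard_setOf _ (M.measurableSet_N t i)

theorem N_congr_claims (t : ℝ) (i : Fin d) (e : Fin d × ℕ → ℝ)
    (κ : Label d → (Fin d → ℝ) × (Fin d → ℕ)) (δ : Label d × Fin d × ℕ → ℝ)
    (v v' : Fin d × ℕ → Fin dstar → ℝ) : M.N t i (e, κ, δ, v) = M.N t i (e, κ, δ, v') := by
  rw [N_eq, N_eq]
  rfl

theorem measurable_Z (t : ℝ) : Measurable (M.Z t) := by
  refine measurable_pi_lambda _ fun i => ?_
  refine Finset.measurable_fun_sum _ fun j _ => ?_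
  have h : Measurable fun x : Sample d dstar × ℕ =>
      ∑ r ∈ Finset.range x.2, x.1.2.2.2 (j, r) i := by
    refine measurable_from_prod_countable_left fun n => ?_
    exact Finset.measurable_fun_sum (Finset.range n) fun r _ =>
      (by fun_prop : Measurable fun ω : Sample d dstar => ω.2.2.2 (j, r) i)
  exact h.comp (measurable_id.prodMk (M.measurable_N t j))

theorem lintegral_claims (θ : Fin dstar → ℝ) (n : Fin d → ℕ) :
    ∫⁻ v : Fin d × ℕ → Fin dstar → ℝ,
      ENNReal.ofReal (Real.exp (θ ⬝ᵥ fun i => ∑ j, ∑ r ∈ Finset.range (n j), v (j, r) i))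
      ∂(Measure.infinitePi fun q : Fin d × ℕ => M.claimLaw q.1) = ∏ j, M.mgfU θ j ^ n j := by
  set s : Finset (Fin d × ℕ) := (Finset.univ.sigma fun j => Finset.range (n j)).map
    (Equiv.sigmaEquivProd (Fin d) ℕ).toEmbedding with hs
  have h : ∀ v : Fin d × ℕ → Fin dstar → ℝ,
      ENNReal.ofReal (Real.exp (θ ⬝ᵥ fun i => ∑ j, ∑ r ∈ Finset.range (n j), v (j, r) i)) =
        ∏ q ∈ s, ENNReal.ofReal (Real.exp (θ ⬝ᵥ v q)) := by
    intro v
    rw [← ENNReal.ofReal_prod_of_nonneg fun _ _ => (Real.exp_pos _).le, ← Real.exp_sum]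
    congr 2
    rw [hs, Finset.sum_map, Finset.sum_sigma]
    simp only [dotProduct, Finset.mul_sum, Equiv.coe_toEmbedding, Equiv.sigmaEquivProd_apply]
    rw [Finset.sum_comm]
    refine Finset.sum_congr rfl fun j _ => ?_
    rw [Finset.sum_comm]
  simp only [h]
  rw [lintegral_finsetProd_infinitePi (fun q : Fin d × ℕ => M.claimLaw q.1) s
    (fun _ v => ENNReal.ofReal (Real.exp (θ ⬝ᵥ v))) fun q => by
      simp only [dotProduct]; fun_prop]
  rw [hs, Finset.prod_map, Finset.prod_sigma]
  refine Finset.prod_congr rfl fun j _ => ?_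
  simp [mgfU]

theorem mgfZ_eq (t : ℝ) (θ : Fin dstar → ℝ) :
    M.mgfZ t θ = ∫⁻ e, ∫⁻ κ, ∫⁻ δ, M.eventWeight (M.mgfU θ) t e κ δ
      ∂(Measure.infinitePi fun q : Label d × Fin d × ℕ => M.delayLaw q.2.1 (comp q.1))
      ∂(Measure.infinitePi fun ℓ : Label d =>
        (M.markLaw (comp ℓ)) ⊗ₘ (M.offspringKernel (comp ℓ)))
      ∂(Measure.infinitePi fun _ : Fin d × ℕ => expMeasure 1) := by
  have hm : Measurable fun ω : Sample d dstar =>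
      ENNReal.ofReal (Real.exp (θ ⬝ᵥ M.Z t ω)) := by
    have := M.measurable_Z t
    simp only [dotProduct]
    fun_prop
  rw [mgfZ, prob, lintegral_prod _ hm.aemeasurable]
  refine lintegral_congr fun e => ?_
  refine (lintegral_prod _
    (hm.comp (measurable_const.prodMk measurable_id)).aemeasurable).trans ?_
  refine lintegral_congr fun κ => ?_
  refine (lintegral_prod _ (hm.comp (measurable_const.prodMk
    (measurable_const.prodMk measurable_id))).aemeasurable).trans ?_
  refine lintegral_congr fun δ => ?_
  rw [eventWeight, ← lintegral_claims]
  refine lintegral_congr fun v => ?_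
  have : M.Z t (e, κ, δ, v) = fun i => ∑ j, ∑ r ∈ Finset.range (M.N t j (e, κ, δ, 0)),
      v (j, r) i := by
    funext i
    simp only [Z, M.N_congr_claims t _ e κ δ v 0]
  rw [← this]
  rfl

/-! ### Independence of the clusters -/

theorem map_treeDelayLaw :
    (Measure.infinitePi fun q : Label d × Fin d × ℕ => M.delayLaw q.2.1 (comp q.1)).map
      (fun δ (x : (Fin d × ℕ) × List (Fin d × ℕ) × Fin d × ℕ) => δ ((x.1, x.2.1), x.2.2)) =
    Measure.infinitePi fun x : (Fin d × ℕ) × List (Fin d × ℕ) × Fin d × ℕ =>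
      M.delayLaw x.2.2.1 (kind x.1.1 x.2.1) := by
  have hinj : Function.Injective fun x : (Fin d × ℕ) × List (Fin d × ℕ) × Fin d × ℕ =>
      (((x.1, x.2.1), x.2.2) : Label d × Fin d × ℕ) := by
    rintro ⟨a, p, q⟩ ⟨a', p', q'⟩ h
    simp only [Prod.mk.injEq] at h
    obtain ⟨⟨rfl, rfl⟩, rfl⟩ := h
    rfl
  rw [Measure.map_infinitePi_infinitePi_of_inj hinj]
  simp only [comp_eq_kind]

theorem lintegral_prod_treeWeight (z : Fin d → ℝ≥0∞) (s : Finset (Fin d × ℕ))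
    (u : Fin d × ℕ → ℝ) :
    ∫⁻ κ, ∫⁻ δ, ∏ a ∈ s, treeWeight z a.1 (u a) (fun p => κ (a, p))
        (fun q => δ ((a, q.1), q.2))
      ∂(Measure.infinitePi fun q : Label d × Fin d × ℕ => M.delayLaw q.2.1 (comp q.1))
      ∂(Measure.infinitePi fun ℓ : Label d =>
        (M.markLaw (comp ℓ)) ⊗ₘ (M.offspringKernel (comp ℓ))) =
      ∏ a ∈ s, M.clusterPgf z a.1 (u a) := by
  have hδ : ∀ κ : Label d → (Fin d → ℝ) × (Fin d → ℕ),
      ∫⁻ δ, ∏ a ∈ s, treeWeight z a.1 (u a) (fun p => κ (a, p)) (fun q => δ ((a, q.1), q.2))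
        ∂(Measure.infinitePi fun q : Label d × Fin d × ℕ => M.delayLaw q.2.1 (comp q.1)) =
      ∏ a ∈ s, ∫⁻ D, treeWeight z a.1 (u a) (fun p => κ (a, p)) D ∂M.treeDelayLaw a.1 := by
    intro κ
    have hw : ∀ a : Fin d × ℕ, Measurable (treeWeight z a.1 (u a) fun p => κ (a, p)) := fun a =>
      measurable_treeWeight z a.1 measurable_const measurable_const measurable_id
    have := lintegral_finsetProd_blocks (fun x : (Fin d × ℕ) × List (Fin d × ℕ) × Fin d × ℕ =>
      M.delayLaw x.2.2.1 (kind x.1.1 x.2.1)) s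
      (fun a D => treeWeight z a.1 (u a) (fun p => κ (a, p)) D) hw
    rw [← map_treeDelayLaw, lintegral_map _ (by fun_prop)] at this
    · exact this
    · exact Finset.measurable_fun_prod _ fun a _ => (hw a).comp (by fun_prop)
  simp only [hδ]
  have hm : ∀ a : Fin d × ℕ, Measurable fun K =>
      ∫⁻ D, treeWeight z a.1 (u a) K D ∂M.treeDelayLaw a.1 := fun a =>
    Measurable.lintegral_prod_right' (f := fun x : Litters d × Delays d =>
      treeWeight z a.1 (u a) x.1 x.2)
      (measurable_treeWeight z a.1 measurable_const measurable_fst measurable_snd)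
  rw [lintegral_finsetProd_blocks (fun ℓ : Label d =>
    (M.markLaw (comp ℓ)) ⊗ₘ (M.offspringKernel (comp ℓ))) s
    (fun a K => ∫⁻ D, treeWeight z a.1 (u a) K D ∂M.treeDelayLaw a.1) hm]
  refine Finset.prod_congr rfl fun a _ => ?_
  rw [clusterPgf, litterLaw]
  simp only [comp_eq_kind]
  rfl

/-- If only immigrants with a number less than `n` arrive up to time `t`, then the events up to
time `t` are those of the first `n` clusters of each component. -/
theorem eventWeight_eq_prod (z : Fin d → ℝ≥0∞) {t : ℝ} {n : ℕ} {e : Fin d × ℕ → ℝ}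
    (he : ∀ q, 0 < e q)
    (hn : ∀ j, 0 < M.rate j → M.rate j * t < ∑ k ∈ Finset.range n, e (j, k))
    {κ : Label d → (Fin d → ℝ) × (Fin d → ℕ)} (hκ : ∀ a, ∃ n, gen (fun p => κ (a, p)) n = ∅)
    {δ : Label d × Fin d × ℕ → ℝ} (hδ : ∀ q, 0 < δ q) :
    M.eventWeight z t e κ δ =
      ∏ a ∈ (Finset.univ.filter fun j => 0 < M.rate j) ×ˢ Finset.range n,
        treeWeight z a.1 (t - (∑ k ∈ Finset.range (a.2 + 1), e (a.1, k)) / M.rate a.1)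
          (fun p => κ (a, p)) fun q => δ ((a, q.1), q.2) := by
  choose s hs _ using fun a => exists_finset_treeBorn (hκ a)
  set S : Finset (Label d) :=
    (((Finset.univ.filter fun j => 0 < M.rate j) ×ˢ Finset.range n).sigma fun a =>
      (s a).filter fun p => TreeAge (fun q => δ ((a, q.1), q.2)) p ≤
        t - (∑ k ∈ Finset.range (a.2 + 1), e (a.1, k)) / M.rate a.1).map
      (Equiv.sigmaEquivProd _ _).toEmbedding with hS
  have hmem : ∀ ℓ : Label d, (0 < M.rate ℓ.1.1 ∧ TreeBorn (fun p => κ (ℓ.1, p)) ℓ.2 ∧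
      TreeAge (fun q => δ ((ℓ.1, q.1), q.2)) ℓ.2 ≤ t - M.arrival (e, κ, δ, 0) ℓ.1) ↔ ℓ ∈ S := by
    rintro ⟨a, p⟩
    simp only [hS, Finset.mem_map_equiv, Equiv.sigmaEquivProd_symm_apply, Finset.mem_sigma,
      Finset.mem_product, Finset.mem_filter, Finset.mem_univ, true_and, Finset.mem_range, ← hs,
      arrival]
    refine ⟨fun ⟨h1, h2, h3⟩ => ⟨⟨h1, ?_⟩, h2, h3⟩, fun ⟨⟨h1, _⟩, h2, h3⟩ => ⟨h1, h2, h3⟩⟩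
    by_contra hlt
    have h0 := treeAge_nonneg (D := fun q => δ ((a, q.1), q.2)) (fun q => hδ _) p
    have hr : (0 : ℝ) < M.rate a.1 := h1
    have h4 : (∑ k ∈ Finset.range (a.2 + 1), e (a.1, k)) / M.rate a.1 ≤ t := by linarith
    rw [div_le_iff₀ hr] at h4
    have h5 : ∑ k ∈ Finset.range n, e (a.1, k) ≤ ∑ k ∈ Finset.range (a.2 + 1), e (a.1, k) :=
      Finset.sum_le_sum_of_subset_of_nonneg (Finset.range_subset_range.2 (by omega))
        fun k _ _ => (he _).le
    linarith [hn a.1 h1]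
  simp only [eventWeight, N_eq]
  rw [prod_pow_ncard_eq z comp hmem, hS, Finset.prod_map, Finset.prod_sigma]
  refine Finset.prod_congr rfl fun a _ => ?_
  rw [treeWeight_eq_prod z a.1 _ _ (hs a)]
  exact Finset.prod_congr rfl fun p _ => by
    rw [Equiv.coe_toEmbedding, Equiv.sigmaEquivProd_apply, comp_eq_kind]

theorem lintegral_eventWeight (z : Fin d → ℝ≥0∞) {t : ℝ} {n : ℕ} {e : Fin d × ℕ → ℝ}
    (hfin : ∀ j, ∀ᵐ K ∂litterLaw M.litter j, ∃ n, gen K n = ∅) (he : ∀ q, 0 < e q)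
    (hn : ∀ j, 0 < M.rate j → M.rate j * t < ∑ k ∈ Finset.range n, e (j, k)) :
    ∫⁻ κ, ∫⁻ δ, M.eventWeight z t e κ δ
      ∂(Measure.infinitePi fun q : Label d × Fin d × ℕ => M.delayLaw q.2.1 (comp q.1))
      ∂(Measure.infinitePi fun ℓ : Label d =>
        (M.markLaw (comp ℓ)) ⊗ₘ (M.offspringKernel (comp ℓ))) =
      ∏ a ∈ (Finset.univ.filter fun j => 0 < M.rate j) ×ˢ Finset.range n,
        M.clusterPgf z a.1
          (t - (∑ k ∈ Finset.range (a.2 + 1), e (a.1, k)) / M.rate a.1) := by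
  rw [← lintegral_prod_treeWeight]
  have hκ : ∀ᵐ κ ∂(Measure.infinitePi fun ℓ : Label d =>
      (M.markLaw (comp ℓ)) ⊗ₘ (M.offspringKernel (comp ℓ))),
      ∀ a, ∃ n, gen (fun p => κ (a, p)) n = ∅ := by
    refine ae_all_iff.2 fun a => ?_
    have := hfin a.1
    rw [← M.map_litterLaw a] at this
    exact ae_of_ae_map (f := fun (κ : Label d → (Fin d → ℝ) × (Fin d → ℕ)) p => κ (a, p))
      (Measurable.aemeasurable (by fun_prop)) this
  refine lintegral_congr_ae ?_
  filter_upwards [hκ] with κ hκ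
  refine lintegral_congr_ae ?_
  filter_upwards [ae_infinitePi_forall (fun q : Label d × Fin d × ℕ =>
    M.delayLaw q.2.1 (comp q.1)) fun q => M.ae_delayLaw_pos _ _] with δ hδ
  exact M.eventWeight_eq_prod z he hn hκ hδ

/-! ### The moment generating function of the compound process -/

/-- The exponent `rate_j ∫_0^t E[∏_l z_l ^ S_{l←j}(u)] - 1 du`, in the time scale in which the
immigrants of component `j` arrive at rate one. -/
noncomputable def clusterExponent (z : Fin d → ℝ≥0∞) (j : Fin d) (t : ℝ) : ℝ :=
  (∫ s in (0 : ℝ)..M.rate j * t, (M.clusterPgf z j (s / M.rate j)).toReal) - M.rate j * t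

theorem mgfZ_eq_prod {θ : Fin dstar → ℝ} {w : Fin d → ℝ≥0∞}
    (hfin : ∀ j, ∀ᵐ K ∂litterLaw M.litter j, ∃ n, gen K n = ∅)
    (hzw : ∀ l, M.mgfU θ l ≤ w l) (hw : ∀ l, 1 ≤ w l) (hwfin : ∀ j, M.totalPgf w j ≠ ∞)
    {t : ℝ} (ht : 0 ≤ t) :
    M.mgfZ t θ = ∏ j ∈ Finset.univ.filter fun j => 0 < M.rate j,
      ENNReal.ofReal (Real.exp (M.clusterExponent (M.mgfU θ) j t)) := by
  set z := M.mgfU θ with hz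
  set R : Finset (Fin d) := Finset.univ.filter fun j => 0 < M.rate j with hR
  have hrate : ∀ j ∈ R, (0 : ℝ) < M.rate j := fun j hj => (Finset.mem_filter.1 hj).2
  have hne : ∀ j u, M.clusterPgf z j u ≠ ∞ := fun j u =>
    ne_top_of_le_ne_top (hwfin j) (M.clusterPgf_le (hfin j) hzw hw u)
  -- The factor that belongs to the immigrants of one component.
  set φ : ℕ → Fin d → (ℕ → ℝ) → ℝ≥0∞ := fun n j e =>
    (Set.Ioi (M.rate j * t)).indicator 1 (∑ k ∈ Finset.range n, e k) *
      ∏ r ∈ Finset.range n, ENNReal.ofReal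
        (M.clusterPgf z j ((M.rate j * t - ∑ k ∈ Finset.range (r + 1), e k) / M.rate j)).toReal
    with hφ
  have hφm : ∀ n j, Measurable (φ n j) := by
    intro n j
    refine Measurable.mul ((measurable_one.indicator measurableSet_Ioi).comp (by fun_prop)) ?_
    refine Finset.measurable_fun_prod _ fun r _ => ?_
    exact (((M.measurable_clusterPgf z j).comp (by fun_prop)).ennreal_toReal).ennreal_ofReal
  set μ := Measure.infinitePi fun _ : Fin d × ℕ => expMeasure 1 with hμ
  have hlim1 : Tendsto (fun n => ∫⁻ e, ∏ j ∈ R, φ n j (fun k => e (j, k)) ∂μ) atTop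
      (𝓝 (∏ j ∈ R, ENNReal.ofReal (Real.exp (M.clusterExponent z j t)))) := by
    have h1 : ∀ n, ∫⁻ e, ∏ j ∈ R, φ n j (fun k => e (j, k)) ∂μ =
        ∏ j ∈ R, ∫⁻ e, φ n j e ∂Measure.infinitePi fun _ : ℕ => expMeasure 1 := fun n =>
      lintegral_finsetProd_blocks (fun _ : Fin d × ℕ => expMeasure 1) R (φ n) (hφm n)
    simp only [h1]
    have h2 : ∀ j ∈ R, Tendsto
        (fun n => ∫⁻ e, φ n j e ∂Measure.infinitePi fun _ : ℕ => expMeasure 1) atTop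
        (𝓝 (ENNReal.ofReal (Real.exp (M.clusterExponent z j t)))) := by
      intro j hj
      have hr := hrate j hj
      refine tendsto_lintegral_poisson_prod
        (H := fun s => (M.clusterPgf z j (s / M.rate j)).toReal) (C := (M.totalPgf w j).toReal)
        (fun s => ENNReal.toReal_nonneg) (fun s => ?_) ?_ (fun s _ => ?_) (fun s hs => ?_)
        (mul_nonneg hr.le ht)
      · exact ENNReal.toReal_mono (hwfin j) (M.clusterPgf_le (hfin j) hzw hw _)
      · exact ((M.measurable_clusterPgf z j).comp (by fun_prop)).ennreal_toReal
      · have hc := M.continuousWithinAt_clusterPgf (hfin j) hzw hw (hwfin j) (s / M.rate j)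
        refine (ENNReal.tendsto_toReal (hne j _)).comp (hc.tendsto.comp ?_)
        refine tendsto_nhdsWithin_of_tendsto_nhds_of_eventually_within _
          (((continuous_id.div_const _).tendsto s).mono_left nhdsWithin_le_nhds) ?_
        filter_upwards [self_mem_nhdsWithin] with v hv
        exact div_lt_div_of_pos_right hv hr
      · rw [M.clusterPgf_of_neg z j (div_neg_of_neg_of_pos hs hr), ENNReal.toReal_one]
    exact ENNReal.tendsto_finsetProd_of_ne_top R h2 fun _ _ => ENNReal.ofReal_ne_top
  rw [mgfZ_eq]
  refine tendsto_nhds_unique ?_ hlim1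
  have hpos : ∀ᵐ e ∂μ, ∀ q, 0 < e q :=
    ae_infinitePi_forall (fun _ : Fin d × ℕ => expMeasure 1) fun _ => ae_expMeasure_one_pos
  have hex : ∀ᵐ e ∂μ, ∀ j, ∃ n, M.rate j * t < ∑ k ∈ Finset.range n, e (j, k) := by
    refine ae_all_iff.2 fun j => ?_
    have h := ae_exists_lt_sum_range (M.rate j * t)
    rw [← Measure.map_infinitePi_infinitePi_of_inj (P := fun _ : Fin d × ℕ => expMeasure 1)
      (f := fun k : ℕ => (j, k)) fun k k' h => (Prod.mk.inj h).2] at h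
    exact ae_of_ae_map (f := fun (e : Fin d × ℕ → ℝ) k => e (j, k))
      (Measurable.aemeasurable (by fun_prop)) h
  -- The product of the `φ n j` vanishes unless every component has less than `n` immigrants up to
  -- time `t`.
  have hval : ∀ e : Fin d × ℕ → ℝ, (∀ q, 0 < e q) → ∀ n,
      ∏ j ∈ R, φ n j (fun k => e (j, k)) =
        if ∀ j ∈ R, M.rate j * t < ∑ k ∈ Finset.range n, e (j, k) then
          ∫⁻ κ, ∫⁻ δ, M.eventWeight z t e κ δ
            ∂(Measure.infinitePi fun q : Label d × Fin d × ℕ => M.delayLaw q.2.1 (comp q.1))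
            ∂(Measure.infinitePi fun ℓ : Label d =>
              (M.markLaw (comp ℓ)) ⊗ₘ (M.offspringKernel (comp ℓ)))
        else 0 := by
    intro e he n
    split_ifs with h
    · rw [M.lintegral_eventWeight z hfin he fun j hj => h j (by simp [hR, hj]),
        Finset.prod_product]
      refine Finset.prod_congr rfl fun j hj => ?_
      simp only [hφ]
      rw [Set.indicator_of_mem (by exact h j hj), Pi.one_apply, one_mul]
      refine Finset.prod_congr rfl fun r _ => ?_
      rw [ENNReal.ofReal_toReal (hne j _), sub_div, mul_div_cancel_left₀ _ (hrate j hj).ne']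
    · push Not at h
      obtain ⟨j, hj, h⟩ := h
      refine Finset.prod_eq_zero hj ?_
      simp only [hφ]
      rw [Set.indicator_of_notMem (by simpa using h), zero_mul]
  refine lintegral_tendsto_of_tendsto_of_monotone (fun n => ?_) ?_ ?_
  · exact (Finset.measurable_fun_prod _ fun j _ => (hφm n j).comp (by fun_prop)).aemeasurable
  · filter_upwards [hpos] with e he n n' hnn'
    simp only [hval e he]
    split_ifs with h h'
    · exact le_rfl
    · refine absurd (fun j hj => (h j hj).trans_le ?_) h'
      exact Finset.sum_le_sum_of_subset_of_nonneg (Finset.range_subset_range.2 hnn')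
        fun k _ _ => (he _).le
    · exact zero_le
    · exact le_rfl
  · filter_upwards [hpos, hex] with e he hexe
    choose m hm using hexe
    refine tendsto_const_nhds.congr' ?_
    filter_upwards [eventually_ge_atTop (Finset.univ.sup m)] with n hn
    rw [hval e he, if_pos]
    intro j _
    refine (hm j).trans_le ?_
    exact Finset.sum_le_sum_of_subset_of_nonneg
      (Finset.range_subset_range.2 ((Finset.le_sup (Finset.mem_univ j)).trans hn))
      fun k _ _ => (he _).le

theorem tendsto_integral_div {H : ℝ → ℝ} {C L : ℝ} (hH0 : ∀ s, 0 ≤ H s) (hHC : ∀ s, H s ≤ C)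
    (hHm : Measurable H) (hL : Tendsto H atTop (𝓝 L)) {r : ℝ} (hr : 0 < r) :
    Tendsto (fun t : ℝ => 1 / t * ∫ s in (0 : ℝ)..r * t, H s) atTop (𝓝 (r * L)) := by
  have h1 : Tendsto (fun t : ℝ => ∫ s in (0 : ℝ)..1, H (r * t * s)) atTop
      (𝓝 (∫ _s in (0 : ℝ)..1, L)) := by
    refine intervalIntegral.tendsto_integral_filter_of_dominated_convergence (fun _ => C)
      (Eventually.of_forall fun t => (hHm.comp (by fun_prop)).aestronglyMeasurable)
      (Eventually.of_forall fun t => ae_of_all _ fun s _ =>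
        (Real.norm_of_nonneg (hH0 _)).trans_le (hHC _)) intervalIntegrable_const
      (ae_of_all _ fun s hs => ?_)
    have hs0 : 0 < s := by
      rw [Set.uIoc_of_le zero_le_one] at hs
      exact hs.1
    exact hL.comp ((tendsto_id.const_mul_atTop hr).atTop_mul_const hs0)
  simp only [intervalIntegral.integral_const, sub_zero, one_smul] at h1
  refine (h1.const_mul r).congr' ?_
  filter_upwards [eventually_gt_atTop 0] with t ht
  rw [intervalIntegral.integral_comp_mul_left H (mul_pos hr ht).ne', mul_zero, mul_one,
    smul_eq_mul]
  field_simp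

theorem Lam_eq {θ : Fin dstar → ℝ} (h : ∀ j, M.totalPgf (M.mgfU θ) j ≠ ∞) :
    M.Lam θ = ((∑ j, M.rate j * ((M.totalPgf (M.mgfU θ) j).toReal - 1) : ℝ) : EReal) := by
  rw [Lam]
  refine (Finset.sum_congr rfl fun j _ => ?_).trans (map_sum
    (⟨⟨((↑) : ℝ → EReal), EReal.coe_zero⟩, EReal.coe_add⟩ : ℝ →+ EReal) _ _).symm
  change _ = (((M.rate j : ℝ) * ((M.totalPgf (M.mgfU θ) j).toReal - 1) : ℝ) : EReal)
  rw [f_eq_totalPgf, EReal.coe_mul, EReal.coe_sub, EReal.coe_one,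
    EReal.coe_ennreal_toReal (h j)]

/-- The limit of the scaled cumulant generating functions, for the weights that are dominated by
weights `w ≥ 1` with a finite generating function. -/
theorem tendsto_log_mgfZ {θ : Fin dstar → ℝ} {w : Fin d → ℝ≥0∞}
    (hfin : ∀ j, ∀ᵐ K ∂litterLaw M.litter j, ∃ n, gen K n = ∅)
    (hzw : ∀ l, M.mgfU θ l ≤ w l) (hw : ∀ l, 1 ≤ w l) (hwfin : ∀ j, M.totalPgf w j ≠ ∞)
    (hzfin : ∀ j, M.totalPgf (M.mgfU θ) j ≠ ∞) :
    Tendsto (fun t : ℝ => ((1 / t : ℝ) : EReal) * ENNReal.log (M.mgfZ t θ)) atTop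
      (𝓝 (M.Lam θ)) := by
  set z := M.mgfU θ with hz
  set R : Finset (Fin d) := Finset.univ.filter fun j => 0 < M.rate j with hR
  rw [M.Lam_eq hzfin]
  have hreal : Tendsto (fun t : ℝ => ∑ j ∈ R, 1 / t * M.clusterExponent z j t) atTop
      (𝓝 (∑ j, M.rate j * ((M.totalPgf z j).toReal - 1))) := by
    have hsum : ∑ j, (M.rate j : ℝ) * ((M.totalPgf z j).toReal - 1) =
        ∑ j ∈ R, (M.rate j : ℝ) * ((M.totalPgf z j).toReal - 1) := by
      refine (Finset.sum_filter_of_ne fun j _ h => ?_).symm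
      exact pos_iff_ne_zero.2 fun h0 => h (by simp [h0])
    rw [hsum]
    refine tendsto_finsetSum _ fun j hj => ?_
    have hr : (0 : ℝ) < M.rate j := (Finset.mem_filter.1 hj).2
    have h1 := tendsto_integral_div
      (H := fun s => (M.clusterPgf z j (s / M.rate j)).toReal) (C := (M.totalPgf w j).toReal)
      (L := (M.totalPgf z j).toReal) (fun s => ENNReal.toReal_nonneg)
      (fun s => ENNReal.toReal_mono (hwfin j) (M.clusterPgf_le (hfin j) hzw hw _))
      ((M.measurable_clusterPgf z j).comp (by fun_prop)).ennreal_toReal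
      ((ENNReal.tendsto_toReal (hzfin j)).comp
        ((M.tendsto_clusterPgf_atTop (hfin j) hzw hw (hwfin j)).comp
          (tendsto_id.atTop_div_const hr))) hr
    rw [mul_sub, mul_one]
    refine (h1.sub_const (M.rate j : ℝ)).congr' ?_
    filter_upwards [eventually_gt_atTop 0] with t ht
    rw [clusterExponent]
    field_simp
  refine ((continuous_coe_real_ereal.tendsto _).comp hreal).congr' ?_
  filter_upwards [eventually_ge_atTop 0] with t ht
  rw [Function.comp_apply, M.mgfZ_eq_prod hfin hzw hw hwfin ht,
    ← ENNReal.ofReal_prod_of_nonneg fun _ _ => (Real.exp_pos _).le, ← Real.exp_sum,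
    ENNReal.log_ofReal_of_pos (Real.exp_pos _), Real.log_exp, ← Finset.mul_sum, EReal.coe_mul]

theorem mem_domain_of_totalPgf_ne_top {θ : Fin dstar → ℝ}
    (h : ∀ j, M.totalPgf (M.mgfU θ) j ≠ ∞) : θ ∈ M.domain := by
  change M.Lam θ < ⊤
  rw [M.Lam_eq h]
  exact EReal.coe_lt_top _

theorem mgfU_mono {θ θ' : Fin dstar → ℝ} (h : θ ≤ θ') (j : Fin d) :
    M.mgfU θ j ≤ M.mgfU θ' j := by
  refine lintegral_mono_ae ?_
  filter_upwards [M.claimLaw_nonneg j] with v hv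
  exact ENNReal.ofReal_le_ofReal (Real.exp_le_exp.2
    (Finset.sum_le_sum fun i _ => mul_le_mul_of_nonneg_right (h i) (hv i)))

/-- By continuity of moment generating functions, `m_U` is as close to `1` as desired at some
vector with positive entries. -/
theorem exists_mgfU_le {η : Fin dstar → ℝ} (hη : ∀ i, 0 < η i) (hfin : ∀ j, M.mgfU η j < ∞)
    {ζ : ℝ} (hζ : 1 < ζ) :
    ∃ t : ℝ, 0 < t ∧ ∀ j, M.mgfU (t • η) j ≤ ENNReal.ofReal ζ := by
  set Y : (Fin dstar → ℝ) → ℝ := fun v => ∑ i, v i * η i with hY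
  have hint : ∀ j, 0 ∈ interior (integrableExpSet Y (M.claimLaw j)) := by
    intro j
    obtain ⟨t, ht, htI⟩ := exists_integrable_exp_of_lintegral_lt_top (M.claimLaw_nonneg j) hη
      (by simpa [mgfU, dotProduct, mul_comm] using hfin j) η
    refine zero_mem_interior_integrableExpSet (by fun_prop) ?_ ht htI
    filter_upwards [M.claimLaw_nonneg j] with v hv
    exact Finset.sum_nonneg fun i _ => mul_nonneg (hv i) (hη i).le
  have hev : ∀ᶠ t : ℝ in 𝓝[>] 0, ∀ j, mgf Y (M.claimLaw j) t < ζ ∧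
      t ∈ integrableExpSet Y (M.claimLaw j) := by
    refine eventually_all.2 fun j => nhdsWithin_le_nhds (Eventually.and ?_
      (mem_interior_iff_mem_nhds.1 (hint j)))
    have hc : ContinuousAt (mgf Y (M.claimLaw j)) 0 := (hasDerivAt_mgf (hint j)).continuousAt
    exact hc.eventually (gt_mem_nhds (by simpa using hζ))
  obtain ⟨t, ht, htpos⟩ := (hev.and self_mem_nhdsWithin).exists
  refine ⟨t, htpos, fun j => ?_⟩
  have : M.mgfU (t • η) j = ENNReal.ofReal (mgf Y (M.claimLaw j) t) := by
    rw [mgf, ofReal_integral_eq_lintegral_ofReal (ht j).2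
      (ae_of_all _ fun _ => (Real.exp_pos _).le)]
    refine lintegral_congr fun v => ?_
    congr 2
    simp only [hY, dotProduct, Finset.mul_sum, Pi.smul_apply, smul_eq_mul]
    exact Finset.sum_congr rfl fun i _ => by ring
  rw [this]
  exact ENNReal.ofReal_le_ofReal (ht j).1.le

end HawkesModel

open HawkesModel in
theorem lemma3p2 {d dstar : ℕ} (M : HawkesModel d dstar)
    (hstable : M.Stable) (hmarks : M.MarksLightTailed) :
    ((∃ η : Fin dstar → ℝ, (∀ i, 0 < η i) ∧ ∀ j, M.mgfU η j < ∞) →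
      (0 : Fin dstar → ℝ) ∈ interior M.domain) ∧
    ∀ (r xhat zhat : Fin d → ℝ) (θhat : Fin dstar → ℝ),
      M.IsCritical r xhat zhat → (∀ j, 1 ≤ zhat j) →
      (∀ j, M.mgfU θhat j = ENNReal.ofReal (zhat j)) →
      ∀ θ : Fin dstar → ℝ, θ ≤ θhat →
        θ ∈ M.domain ∧
        Tendsto (fun t : ℝ => ((1 / t : ℝ) : EReal) * ENNReal.log (M.mgfZ t θ)) atTop
          (𝓝 (M.Lam θ)) := by
  obtain ⟨ζ, x, hζ, hx1, hx⟩ := M.exists_supersolution hstable hmarks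
  have hfin : ∀ j, ∀ᵐ K ∂litterLaw M.litter j, ∃ n, gen K n = ∅ := fun j =>
    ae_exists_gen_eq_empty M.litter (ENNReal.one_lt_ofReal.2 hζ)
      (fun i => ENNReal.one_le_ofReal.2 (hx1 i)) (fun i => ENNReal.ofReal_ne_top) hx j
  constructor
  · rintro ⟨η, hη, hηfin⟩
    obtain ⟨t, ht, htζ⟩ := M.exists_mgfU_le hη hηfin hζ
    refine mem_interior.2 ⟨{θ | ∀ i, θ i < (t • η) i}, fun θ hθ => ?_, ?_,
      fun i => mul_pos ht (hη i)⟩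
    · refine M.mem_domain_of_totalPgf_ne_top fun j => ne_top_of_le_ne_top ENNReal.ofReal_ne_top
        (lintegral_prod_pow_ncard_le M.litter (x := fun i => ENNReal.ofReal (x i))
          (fun i => ?_) j (hfin j))
      exact (mul_le_mul_left ((M.mgfU_mono (fun i => (hθ i).le) i).trans (htζ i)) _).trans (hx i)
    · rw [Set.ofPred_forall]
      exact isOpen_iInter_of_finite fun i => isOpen_lt (by fun_prop) continuous_const
  · intro r xhat zhat θhat hcrit hz hθhat θ hθ
    have hle : ∀ w : Fin d → ℝ≥0∞, (∀ i, w i ≤ ENNReal.ofReal (zhat i)) →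
        ∀ j, M.totalPgf w j ≠ ∞ := fun w hw j =>
      ne_top_of_le_ne_top ENNReal.ofReal_ne_top (lintegral_prod_pow_ncard_le M.litter
        (x := fun i => ENNReal.ofReal (xhat i))
        (fun i => (mul_le_mul_left (hw i) _).trans (hcrit.supersolution M hz i)) j (hfin j))
    have hzw : ∀ l, M.mgfU θ l ≤ ENNReal.ofReal (zhat l) := fun l =>
      (M.mgfU_mono hθ l).trans (hθhat l).le
    exact ⟨M.mem_domain_of_totalPgf_ne_top (hle _ hzw), M.tendsto_log_mgfZ hfin hzw
      (fun l => ENNReal.one_le_ofReal.2 (hz l)) (hle _ fun _ => le_rfl) (hle _ hzw)⟩
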